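/- Throughout, representations are complex. A locally profinite group is a Hausdorff, locally compact, totally disconnected topological group; all such groups here are assumed $\sigma$-compact. A representation $(\pi,V)$ of such a group $G$ is smooth if the stabilizer of every vector is open, and admissible if $V^K$ is finite-dimensional for every compact open subgroup $K$. Let $\mathrm{Irr}(G)$ be the set of isomorphism classes of irreducible smooth representations of $G$. For a smooth representation $\pi$ and $\sigma\in\mathrm{Irr}(G)$ put $m_G(\pi,\sigma)=\dim_{\mathbb C}\mathrm{Hom}_G(\pi,\sigma)$ and $\mathcal R_G(\pi)=\{\sigma\in\mathrm{Irr}(G)\mid \mathrm{Hom}_G(\pi,\sigma)\ne 0\}$. For a closed subgroup $H\subseteq G$ and a smooth representation $(\sigma,W)$ of $H$, $\mathrm{cInd}_H^G\sigma$ is the space of functions $f:G\to W$ with $f(hg)=\sigma(h)f(g)$ for $h\in H$, $g\in G$, that are right invariant under some compact open subgroup of $G$ and have compact support modulo $H$; $G$ acts by right translation. If all irreducible smooth representations of the locally profinite groups $A$, $B$ and $A\times B$ are admissible, every element of $\mathrm{Irr}(A\times B)$ is uniquely of the form $\pi_1\otimes\pi_2$ with $\pi_1\in\mathrm{Irr}(A)$,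 $\pi_2\in\mathrm{Irr}(B)$. A smooth representation $\pi$ of $A\times B$ is then called a theta representation of $A\times B$ if the two projections $\mathcal R_{A\times B}(\pi)\to\mathcal R_A(\pi)$, $\pi_1\otimes\pi_2\mapsto\pi_1$, and $\mathcal R_{A\times B}(\pi)\to\mathcal R_B(\pi)$, $\pi_1\otimes\pi_2\mapsto\pi_2$, are injective and $m_{A\times B}(\pi,\Pi)\le 1$ for all $\Pi\in\mathrm{Irr}(A\times B)$. **Theorem.** Let $G_1,G_2$ be $\sigma$-compact locally profinite groups with open normal subgroups $H_1\subseteq G_1$, $H_2\subseteq G_2$, such that $G_1/H_1$ is abelian, and let $\gamma:G_1/H_1\to G_2/H_2$ be a group isomorphism. Suppose that all irreducible smooth representations of $G_1$, $G_2$, $G_1\times G_2$, $H_1$ and $H_2$ are admissible, and that $\mathcal R_{H_i}(\pi_i|_{H_i})\neq\emptyset$ for every $\pi_i\in\mathrm{Irr}(G_i)$, $i=1,2$. Let $$\Gamma=\{(g_1,g_2)\in G_1\times G_2\mid \gamma(g_1H_1)=g_2H_2\}.$$ If $\rho$ is a smooth representation of $\Gamma$ whose restriction to $H_1\times H_2$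 is a theta representation of $H_1\times H_2$, then $\mathrm{cInd}_\Gamma^{G_1\times G_2}\rho$ is a theta representation of $G_1\times G_2$. -/

import Mathlib

open scoped TensorProduct Pointwise

universe u u' v w

namespace SmoothRep

section Basic

variable {G : Type u} [Group G] [TopologicalSpace G]
variable {V : Type w} [AddCommGroup V] [Module ℂ V]

/-- A complex representation is smooth if the stabilizer of every vector is open. -/
def IsSmooth (π : Representation ℂ G V) : Prop :=
  ∀ x : V, IsOpen {g : G | π g x = x}

/-- A complex representation is admissible if, for every compact open subgroup `K`, its space of
`K`-invariant vectors is finite-dimensional. -/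
def IsAdmissible (π : Representation ℂ G V) : Prop :=
  ∀ K : Subgroup G, IsOpen (K : Set G) → IsCompact (K : Set G) →
    FiniteDimensional ℂ (Representation.invariants (π.comp K.subtype))

/-- `(π, V)` is an irreducible smooth representation, i.e. it represents a class in `Irr(G)`. -/
def IsSmoothIrreducible (π : Representation ℂ G V) : Prop :=
  IsSmooth π ∧ π.IsIrreducible

/-- All irreducible smooth representations of `G` are admissible. (An irreducible smooth
representation of a `σ`-compact locally profinite group has countable dimension, so the universe
`v` is immaterial.) -/
def IrreduciblesAdmissible (G : Type u) [Group G] [TopologicalSpace G] : Prop :=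
  ∀ (V : Type v) [AddCommGroup V] [Module ℂ V] (π : Representation ℂ G V),
    IsSmoothIrreducible π → IsAdmissible π

/-- For an irreducible smooth `σ`: its class belongs to `R_G(π)`, i.e. `Hom_G(π, σ) ≠ 0`. -/
def HasQuotient {W : Type v} [AddCommGroup W] [Module ℂ W]
    (π : Representation ℂ G V) (σ : Representation ℂ G W) : Prop :=
  ∃ f : π.IntertwiningMap σ, f ≠ 0

/-- The multiplicity `m_G(π, σ) = dim Hom_G(π, σ)`, as a cardinal. -/
noncomputable def repMultiplicity {W : Type v} [AddCommGroup W] [Module ℂ W]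
    (π : Representation ℂ G V) (σ : Representation ℂ G W) : Cardinal :=
  Module.rank ℂ (π.IntertwiningMap σ)

/-- `R_G(π) ≠ ∅`: some irreducible smooth representation of `G` is a quotient of `π`. -/
def HasIrreducibleQuotient (π : Representation ℂ G V) : Prop :=
  ∃ (W : Type v) (_ : AddCommGroup W) (_ : Module ℂ W) (σ : Representation ℂ G W),
    IsSmoothIrreducible σ ∧ HasQuotient π σ

end Basic

section Product

variable {G₁ : Type u} {G₂ : Type u'} [Group G₁] [Group G₂]

/-- The representation `π₁ ⊗ π₂` of `G₁ × G₂` on `V₁ ⊗ V₂`. -/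
noncomputable def outerTensor {V₁ : Type v} {V₂ : Type w} [AddCommGroup V₁] [Module ℂ V₁]
    [AddCommGroup V₂] [Module ℂ V₂] (π₁ : Representation ℂ G₁ V₁)
    (π₂ : Representation ℂ G₂ V₂) : Representation ℂ (G₁ × G₂) (V₁ ⊗[ℂ] V₂) :=
  Representation.tprod (π₁.comp (MonoidHom.fst G₁ G₂)) (π₂.comp (MonoidHom.snd G₁ G₂))

variable [TopologicalSpace G₁] [TopologicalSpace G₂] {V : Type w} [AddCommGroup V] [Module ℂ V]

/-- The projection `R_{G₁ × G₂}(π) → R_{G₁}(π)`, `π₁ ⊗ π₂ ↦ π₁`, is injective. -/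
def FstInjective (π : Representation ℂ (G₁ × G₂) V) : Prop :=
  ∀ (V₁ V₁' V₂ V₂' : Type v) [AddCommGroup V₁] [Module ℂ V₁] [AddCommGroup V₁'] [Module ℂ V₁']
    [AddCommGroup V₂] [Module ℂ V₂] [AddCommGroup V₂'] [Module ℂ V₂']
    (π₁ : Representation ℂ G₁ V₁) (π₁' : Representation ℂ G₁ V₁')
    (π₂ : Representation ℂ G₂ V₂) (π₂' : Representation ℂ G₂ V₂'),
    IsSmoothIrreducible π₁ → IsSmoothIrreducible π₁' →
    IsSmoothIrreducible π₂ → IsSmoothIrreducible π₂' →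
    HasQuotient π (outerTensor π₁ π₂) → HasQuotient π (outerTensor π₁' π₂') →
    Nonempty (π₁.Equiv π₁') → Nonempty (π₂.Equiv π₂')

/-- The projection `R_{G₁ × G₂}(π) → R_{G₂}(π)`, `π₁ ⊗ π₂ ↦ π₂`, is injective. -/
def SndInjective (π : Representation ℂ (G₁ × G₂) V) : Prop :=
  ∀ (V₁ V₁' V₂ V₂' : Type v) [AddCommGroup V₁] [Module ℂ V₁] [AddCommGroup V₁'] [Module ℂ V₁']
    [AddCommGroup V₂] [Module ℂ V₂] [AddCommGroup V₂'] [Module ℂ V₂']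
    (π₁ : Representation ℂ G₁ V₁) (π₁' : Representation ℂ G₁ V₁')
    (π₂ : Representation ℂ G₂ V₂) (π₂' : Representation ℂ G₂ V₂'),
    IsSmoothIrreducible π₁ → IsSmoothIrreducible π₁' →
    IsSmoothIrreducible π₂ → IsSmoothIrreducible π₂' →
    HasQuotient π (outerTensor π₁ π₂) → HasQuotient π (outerTensor π₁' π₂') →
    Nonempty (π₂.Equiv π₂') → Nonempty (π₁.Equiv π₁')

/-- `π` is a theta representation of `G₁ × G₂`: both projections from `R_{G₁ × G₂}(π)` are
injective and every irreducible smooth representation of `G₁ × G₂` occurs as a quotient of `π` with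
multiplicity at most one. When the irreducible smooth representations of `G₁ × G₂` are admissible,
each of them is `π₁ ⊗ π₂` for irreducible smooth `π₁`, `π₂`, unique up to isomorphism, so that the
projections are the maps `π₁ ⊗ π₂ ↦ π₁` and `π₁ ⊗ π₂ ↦ π₂`. -/
def IsTheta (π : Representation ℂ (G₁ × G₂) V) : Prop :=
  FstInjective.{u, u', v, w} π ∧ SndInjective.{u, u', v, w} π ∧
    ∀ (W : Type v) [AddCommGroup W] [Module ℂ W] (σ : Representation ℂ (G₁ × G₂) W),
      IsSmoothIrreducible σ → repMultiplicity π σ ≤ 1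

end Product

section Induction

variable {G : Type u} [Group G] [TopologicalSpace G] [IsTopologicalGroup G] (H : Subgroup G)
variable {V : Type w} [AddCommGroup V] [Module ℂ V] (σ : Representation ℂ H V)

/-- The space of the compact induction of `σ` from `H` to `G`: the functions `f : G → V` with
`f (h g) = σ(h) f(g)` which are right invariant under an open subgroup of `G` (in a locally
profinite group, equivalently under a compact open one) and compactly supported modulo `H`. -/
def cIndSpace : Submodule ℂ (G → V) where
  carrier := {f | (∀ (h : H) (g : G), f (h * g) = σ h (f g)) ∧
    (∃ K : Subgroup G, IsOpen (K : Set G) ∧ ∀ g : G, ∀ k ∈ K, f (g * k) = f g) ∧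
    (∃ C : Set G, IsCompact C ∧ Function.support f ⊆ (H : Set G) * C)}
  zero_mem' := by
    refine ⟨by simp, ⟨⊤, by simp, by simp⟩, ⟨∅, by simp, by simp⟩⟩
  add_mem' := by
    rintro f f' ⟨ha, ⟨K, hK, hb⟩, ⟨C, hC, hc⟩⟩ ⟨ha', ⟨K', hK', hb'⟩, ⟨C', hC', hc'⟩⟩
    refine ⟨fun h g => by simp [ha, ha'], ⟨K ⊓ K', ?_, ?_⟩, ⟨C ∪ C', hC.union hC', ?_⟩⟩
    · rw [Subgroup.coe_inf]
      exact hK.inter hK'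
    · intro g k hk
      simp [hb g k hk.1, hb' g k hk.2]
    · rw [Set.mul_union]
      exact (Function.support_add f f').trans (Set.union_subset_union hc hc')
  smul_mem' := by
    rintro c f ⟨ha, ⟨K, hK, hb⟩, ⟨C, hC, hc⟩⟩
    refine ⟨fun h g => by simp [ha], ⟨K, hK, fun g k hk => by simp [hb g k hk]⟩, ⟨C, hC, ?_⟩⟩
    exact (Function.support_const_smul_subset c f).trans hc

/-- The compact induction `cInd_H^G σ`; the group `G` acts by right translation,
`(x • f)(g) = f (g x)`. -/
def cInd : Representation ℂ G (cIndSpace H σ) where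
  toFun x :=
    { toFun := fun f => ⟨fun g => f.1 (g * x), by
        obtain ⟨f, ha, ⟨K, hK, hb⟩, ⟨C, hC, hc⟩⟩ := f
        refine ⟨fun h g => by simp [mul_assoc, ha], ⟨K.comap (MulAut.conj x⁻¹).toMonoidHom,
          ?_, ?_⟩, ⟨C * {x⁻¹}, hC.mul isCompact_singleton, ?_⟩⟩
        · have hcont : Continuous fun y : G => x⁻¹ * y * x⁻¹⁻¹ := by fun_prop
          exact hK.preimage hcont
        · intro g k hk
          have hk' : x⁻¹ * k * x ∈ K := by simpa using hk
          have := hb (g * x) _ hk'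
          simpa [mul_assoc] using this
        · intro g hg
          obtain ⟨h, hh, c, hcC, hhc⟩ := hc (show g * x ∈ Function.support f from hg)
          refine ⟨h, hh, c * x⁻¹, ⟨c, hcC, x⁻¹, rfl, rfl⟩, ?_⟩
          simp only [← mul_assoc]
          exact mul_inv_eq_of_eq_mul hhc⟩
      map_add' := fun _ _ => rfl
      map_smul' := fun _ _ => rfl }
  map_one' := by
    ext f g
    simp
  map_mul' x y := by
    ext f g
    simp [mul_assoc]

end Induction

section Graph

variable {G₁ : Type u} {G₂ : Type u'} [Group G₁] [Group G₂]
variable {H₁ : Subgroup G₁} {H₂ : Subgroup G₂} [H₁.Normal] [H₂.Normal]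

/-- The preimage `Γ` in `G₁ × G₂` of the graph of `γ : G₁ / H₁ ≃ G₂ / H₂`. -/
def graphSubgroup (γ : G₁ ⧸ H₁ ≃* G₂ ⧸ H₂) : Subgroup (G₁ × G₂) where
  carrier := {g | γ (QuotientGroup.mk' H₁ g.1) = QuotientGroup.mk' H₂ g.2}
  one_mem' := by simp
  mul_mem' := by
    intro a b ha hb
    simp only [Set.mem_ofPred_eq] at ha hb ⊢
    rw [Prod.fst_mul, Prod.snd_mul, map_mul, map_mul, map_mul, ha, hb]
  inv_mem' := by
    intro a ha
    simp only [Set.mem_ofPred_eq] at ha ⊢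
    rw [Prod.fst_inv, Prod.snd_inv, map_inv, map_inv, map_inv, ha]

/-- The inclusion `H₁ × H₂ → Γ`. -/
def prodToGraph (γ : G₁ ⧸ H₁ ≃* G₂ ⧸ H₂) : H₁ × H₂ →* graphSubgroup γ where
  toFun h := ⟨(h.1, h.2), by
    change γ (QuotientGroup.mk' H₁ h.1) = QuotientGroup.mk' H₂ h.2
    have e₁ : QuotientGroup.mk' H₁ (h.1 : G₁) = 1 := by simp
    have e₂ : QuotientGroup.mk' H₂ (h.2 : G₂) = 1 := by simp
    rw [e₁, e₂, map_one]⟩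
  map_one' := rfl
  map_mul' _ _ := rfl

end Graph

end SmoothRep

open SmoothRep

/-!
# Compact induction of theta representations

Let `H = H₁ × H₂`, so that `H ≤ Γ ≤ G₁ × G₂`. As `Γ` is open, Frobenius reciprocity embeds
`Hom(cInd ρ, π₁ ⊗ π₂)` in `Hom_Γ(ρ, π₁ ⊗ π₂)` (`eq_zero_of_comp_toCInd_eq_zero`), and every
admissible irreducible smooth representation of `G₁ × G₂` is some `π₁ ⊗ π₂`
(`exists_equiv_outerTensor`). It remains to study `f ∈ Hom_Γ(ρ, π₁ ⊗ π₂)`.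

Fix irreducible quotients `τᵢ` of `πᵢ` over `Hᵢ` and let `Pᵢ = Hom_{Hᵢ}(πᵢ, τᵢ)`, a space of finite
dimension. As `ρ` is a theta representation of `H`, the space `Hom_H(ρ, τ₁ ⊗ τ₂)` is at most a
line, so `(p₁, p₂) ↦ (p₁ ⊗ p₂) ∘ f` is essentially a bilinear form on `P₁ × P₂`. The stabilizer of
`τᵢ` in `Gᵢ` acts projectively on `Pᵢ`, and by Clifford theory this action is irreducible
(`homSpace_le_of_twistStable`). The correspondence `τ₁ ↔ τ₂` defined by `ρ` is compatible with
conjugation by `Γ`, so the stabilizers of `τ₁` and `τ₂` match under `Γ` and the kernels of the form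
are stable (`twistStable_rightKernel`). Hence the form is zero or perfect (`isPerfPair_pairing`),
and for suitable `τ₁`, `τ₂` it vanishes only if `f = 0`.

* Multiplicity one (`exists_smul_eq_of_graphHom`): for `f` and `f'` with forms `B` and `B'`, an
  eigenvalue `c` of `B⁻¹ B'` makes the form of `f' - c f` degenerate, so `f' = c f`.
* Injectivity (`exists_equiv_of_graphHom`): if `π₁ ⊗ π₂` and `π₁ ⊗ π₂'` both occur, the two perfect
  forms identify `Hom_{H₂}(π₂, τ₂)` with `Hom_{H₂}(π₂', τ₂)`, both being dual to `P₁`. The graph of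
  this identification is a proper stable subspace of `Hom_{H₂}(π₂ ⊕ π₂', τ₂)`; by the same Clifford
  theory it has a nonzero common kernel, which is the graph of an equivalence of `π₂` with `π₂'`.
  The other projection is treated by exchanging the two factors.
-/

namespace SmoothRep

/-! ### Compact open subgroups and averaging -/

section Topology

/-- Van Dantzig's theorem: the stabilizer of a compact open neighbourhood of `1` under right
translation is a compact open subgroup. -/
theorem exists_isOpen_isCompact_subgroup {G : Type*} [Group G] [TopologicalSpace G]
    [IsTopologicalGroup G] [T2Space G] [LocallyCompactSpace G] [TotallyDisconnectedSpace G]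
    {U : Set G} (hU : IsOpen U) (h1 : (1 : G) ∈ U) :
    ∃ K : Subgroup G, IsOpen (K : Set G) ∧ IsCompact (K : Set G) ∧ (K : Set G) ⊆ U := by
  obtain ⟨C, hC, hC1, hCU⟩ := exists_compact_subset hU h1
  obtain ⟨W, hW, hW1, hWC⟩ := loc_compact_Haus_tot_disc_of_zero_dim.mem_nhds_iff.1
    (isOpen_interior.mem_nhds hC1)
  have hWcomp : IsCompact W := hC.of_isClosed_subset hW.1 (hWC.trans interior_subset)
  have key : ∃ T ∈ nhds (1 : G), W * T ⊆ W := by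
    refine hWcomp.induction_on (p := fun S => ∃ T ∈ nhds (1 : G), S * T ⊆ W)
      ⟨Set.univ, by simp⟩ (fun _ _ huv ⟨T, hT, h⟩ => ⟨T, hT, (Set.mul_subset_mul_right huv).trans h⟩)
      (fun S S' ⟨T, hT, h⟩ ⟨T', hT', h'⟩ => ⟨T ∩ T', Filter.inter_mem hT hT', ?_⟩) ?_
    · rw [Set.union_mul]
      exact Set.union_subset ((Set.mul_subset_mul_left Set.inter_subset_left).trans h)
        ((Set.mul_subset_mul_left Set.inter_subset_right).trans h')
    · intro x hx
      have hx' : (x, (1 : G)) ∈ (fun p : G × G => p.1 * p.2) ⁻¹' W := by simpa using hx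
      obtain ⟨A, B, hA, hB, hxA, h1B, hAB⟩ :=
        isOpen_prod_iff.1 (continuous_mul.isOpen_preimage W hW.2) x 1 hx'
      refine ⟨A, mem_nhdsWithin_of_mem_nhds (hA.mem_nhds hxA), B, hB.mem_nhds h1B, ?_⟩
      exact Set.mul_subset_iff.2 fun a ha b hb => hAB (Set.mk_mem_prod ha hb)
  obtain ⟨T, hT, hWT⟩ := key
  let K : Subgroup G :=
    { carrier := {g | (∀ x ∈ W, x * g ∈ W) ∧ ∀ x ∈ W, x * g⁻¹ ∈ W}
      one_mem' := by simp
      mul_mem' := fun {a b} ha hb => ⟨fun x hx => by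
          rw [← mul_assoc]; exact hb.1 _ (ha.1 x hx), fun x hx => by
          rw [mul_inv_rev, ← mul_assoc]; exact ha.2 _ (hb.2 x hx)⟩
      inv_mem' := fun {a} ha => ⟨ha.2, by simpa using ha.1⟩ }
  have hKopen : IsOpen (K : Set G) := by
    refine K.isOpen_of_mem_nhds (g := 1) (Filter.mem_of_superset
      (Filter.inter_mem hT (inv_mem_nhds_one G hT)) fun t ht => ⟨fun x hx => ?_, fun x hx => ?_⟩)
    · exact hWT (Set.mul_mem_mul hx ht.1)
    · exact hWT (Set.mul_mem_mul hx ht.2)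
  have hKW : (K : Set G) ⊆ W := fun k hk => by simpa using hk.1 1 hW1
  exact ⟨K, hKopen, hWcomp.of_isClosed_subset (K.isClosed_of_isOpen hKopen) hKW,
    hKW.trans (hWC.trans (interior_subset.trans hCU))⟩

variable {G : Type*} [Group G] [TopologicalSpace G] [IsTopologicalGroup G]
variable {V : Type*} [AddCommGroup V] [Module ℂ V]

/-- The sum over a set of coset representatives of `K` modulo an open subgroup that fixes finitely
many given vectors sends each of these vectors to a `K`-fixed vector. -/
theorem exists_sum_mem_invariants {π : Representation ℂ G V} (hπ : IsSmooth π) (K : Subgroup G)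
    (hK : IsCompact (K : Set G)) {ι : Type*} [Finite ι] (x : ι → V) :
    ∃ s : Finset G, s.Nonempty ∧ (∀ g ∈ s, g ∈ K) ∧
      ∀ i, ∑ g ∈ s, π g (x i) ∈ Representation.invariants (π.comp K.subtype) := by
  classical
  let U : Subgroup K :=
    { carrier := {k | ∀ i, π k (x i) = x i}
      one_mem' := by simp
      mul_mem' := fun {a b} ha hb i => by simp [hb i, ha i]
      inv_mem' := fun {a} ha i => by
        have := congrArg (π (a⁻¹ : K)) (ha i)
        simpa using this.symm }
  have hU : IsOpen (U : Set K) := by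
    have : (U : Set K) = ⋂ i, Subtype.val ⁻¹' {g : G | π g (x i) = x i} := by
      ext k; simp [U]
    rw [this]
    exact isOpen_iInter_of_finite fun i => (hπ (x i)).preimage continuous_subtype_val
  have : CompactSpace K := isCompact_iff_compactSpace.1 hK
  have : Finite (K ⧸ U) := Subgroup.quotient_finite_of_isOpen U hU
  have : Fintype (K ⧸ U) := Fintype.ofFinite _
  let r : K ⧸ U → G := fun c => (c.out : K)
  have hr : Function.Injective r := fun c d h => by
    have : c.out = d.out := Subtype.ext h
    rw [← QuotientGroup.out_eq' c, this, QuotientGroup.out_eq']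
  refine ⟨Finset.univ.image r, ⟨r (1 : K), by simp⟩, ?_, fun i => ?_⟩
  · intro g hg
    obtain ⟨c, -, rfl⟩ := Finset.mem_image.1 hg
    exact c.out.2
  · rw [Finset.sum_image fun a _ b _ h => hr h, Representation.mem_invariants]
    intro k
    rw [map_sum]
    refine Fintype.sum_equiv (MulAction.toPerm k) _ _ fun c => ?_
    have hmem : ((k • c).out)⁻¹ * (k * c.out) ∈ U := by
      rw [← QuotientGroup.eq, QuotientGroup.out_eq', ← smul_eq_mul, ← MulAction.Quotient.smul_coe,
        QuotientGroup.out_eq']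
    have h2 := congrArg (π ((k • c).out : K)) (hmem i)
    rw [← Module.End.mul_apply, ← map_mul] at h2
    simp only [Subgroup.coe_mul, InvMemClass.coe_inv, mul_inv_cancel_left] at h2
    simpa [r] using h2

end Topology

/-! ### Irreducible representations and their twists -/

section Irreducible

variable {G : Type*} [Group G]
variable {V : Type*} [AddCommGroup V] [Module ℂ V] {W : Type*} [AddCommGroup W] [Module ℂ W]
variable {π : Representation ℂ G V} {σ : Representation ℂ G W}

theorem eq_bot_or_eq_top_of_isIrreducible (h : π.IsIrreducible) (N : Submodule ℂ V)
    (hN : ∀ g, ∀ x ∈ N, π g x ∈ N) : N = ⊥ ∨ N = ⊤ := by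
  rcases h.eq_bot_or_eq_top ⟨N, fun g x hx => hN g x hx⟩ with h | h
  · exact Or.inl (congrArg Subrepresentation.toSubmodule h)
  · exact Or.inr (congrArg Subrepresentation.toSubmodule h)

theorem nontrivial_of_isIrreducible (h : π.IsIrreducible) : Nontrivial V := by
  by_contra hV
  rw [not_nontrivial_iff_subsingleton] at hV
  exact (h.toNontrivial.exists_pair_ne).elim fun a ⟨b, hab⟩ =>
    hab (Subrepresentation.toSubmodule_injective (Subsingleton.elim _ _))

theorem isIrreducible_of_forall [Nontrivial V]
    (h : ∀ N : Submodule ℂ V, (∀ g, ∀ x ∈ N, π g x ∈ N) → N = ⊥ ∨ N = ⊤) : π.IsIrreducible where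
  exists_pair_ne := ⟨⊥, ⊤, fun e => bot_ne_top (α := Submodule ℂ V)
    (congrArg Subrepresentation.toSubmodule e)⟩
  eq_bot_or_eq_top N := by
    rcases h N.toSubmodule (fun g x hx => N.apply_mem_toSubmodule g hx) with h | h
    · exact Or.inl (Subrepresentation.toSubmodule_injective h)
    · exact Or.inr (Subrepresentation.toSubmodule_injective h)

theorem injective_of_isIrreducible (hπ : π.IsIrreducible) {f : V →ₗ[ℂ] W}
    (hf : ∀ g x, f (π g x) = σ g (f x)) (h0 : f ≠ 0) : Function.Injective f := by
  rcases eq_bot_or_eq_top_of_isIrreducible hπ (LinearMap.ker f)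
    (fun g x hx => by simp_all) with h | h
  · exact LinearMap.ker_eq_bot.1 h
  · exact absurd (LinearMap.ker_eq_top.1 h) h0

theorem surjective_of_isIrreducible (hσ : σ.IsIrreducible) {f : V →ₗ[ℂ] W}
    (hf : ∀ g x, f (π g x) = σ g (f x)) (h0 : f ≠ 0) : Function.Surjective f := by
  rcases eq_bot_or_eq_top_of_isIrreducible hσ (LinearMap.range f)
    (by rintro g _ ⟨x, rfl⟩; exact ⟨π g x, hf g x⟩) with h | h
  · exact absurd (LinearMap.range_eq_bot.1 h) h0
  · exact LinearMap.range_eq_top.1 h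

theorem exists_equiv_of_bijective {f : V →ₗ[ℂ] W} (hf : ∀ g x, f (π g x) = σ g (f x))
    (hb : Function.Bijective f) : Nonempty (π.Equiv σ) :=
  ⟨Representation.Equiv.mk (LinearEquiv.ofBijective f hb) fun g => LinearMap.ext fun x => hf g x⟩

theorem exists_equiv_of_isIrreducible (hπ : π.IsIrreducible) (hσ : σ.IsIrreducible)
    {f : V →ₗ[ℂ] W} (hf : ∀ g x, f (π g x) = σ g (f x)) (h0 : f ≠ 0) : Nonempty (π.Equiv σ) :=
  exists_equiv_of_bijective hf
    ⟨injective_of_isIrreducible hπ hf h0, surjective_of_isIrreducible hσ hf h0⟩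

theorem equiv_apply_rep (e : π.Equiv σ) (g : G) (x : V) : e (π g x) = σ g (e x) :=
  LinearMap.congr_fun (e.isIntertwining' g) x

variable {H : Subgroup G} [H.Normal]

/-- The twist `h ↦ τ (g h g⁻¹)` of a representation of a normal subgroup. -/
noncomputable def conjRep (τ : Representation ℂ H W) (g : G) : Representation ℂ H W :=
  τ.comp (MulAut.conjNormal g).toMonoidHom

theorem conjRep_apply (τ : Representation ℂ H W) (g : G) (h : H) :
    conjRep τ g h = τ (MulAut.conjNormal g h) := rfl

theorem conjRep_conjRep (τ : Representation ℂ H W) (a b : G) :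
    conjRep (conjRep τ a) b = conjRep τ (a * b) := by
  ext h : 1
  simp [conjRep_apply]

theorem conjRep_one (τ : Representation ℂ H W) : conjRep τ 1 = τ := by
  ext h : 1
  simp [conjRep_apply]

theorem isIrreducible_conjRep {τ : Representation ℂ H W} (hτ : τ.IsIrreducible) (g : G) :
    (conjRep τ g).IsIrreducible := by
  have := nontrivial_of_isIrreducible hτ
  refine isIrreducible_of_forall fun N hN => eq_bot_or_eq_top_of_isIrreducible hτ N fun h x hx => ?_
  have := hN ((MulAut.conjNormal g)⁻¹ h) x hx
  rwa [conjRep_apply, MulAut.apply_inv_self] at this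

variable [TopologicalSpace G] [IsTopologicalGroup G]

theorem IsSmoothIrreducible.conjRep {τ : Representation ℂ H W} (hτ : IsSmoothIrreducible τ)
    (g : G) : IsSmoothIrreducible (conjRep τ g) := by
  refine ⟨fun x => ?_, isIrreducible_conjRep hτ.2 g⟩
  have hc : Continuous fun h : H => MulAut.conjNormal g h := by
    refine Continuous.subtype_mk (f := fun h : H => g * (h : G) * g⁻¹) (by fun_prop) _
  exact (hτ.1 x).preimage hc

end Irreducible

/-! ### Maps from a representation of `G` to an irreducible representation of `H` -/

section HomSpace

/-- A map that vanishes on the common kernel of finitely many maps to irreducible representations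
factors through these maps, by equivariant maps. -/
theorem exists_eq_sum_comp {H : Type*} [Group H] {V W W' ι : Type*} [AddCommGroup V] [Module ℂ V]
    [AddCommGroup W] [Module ℂ W] [AddCommGroup W'] [Module ℂ W'] {π : Representation ℂ H V}
    {τ : ι → Representation ℂ H W} (hτ : ∀ i, (τ i).IsIrreducible) {τ' : Representation ℂ H W'}
    {q : ι → V →ₗ[ℂ] W} (hq : ∀ i h x, q i (π h x) = τ i h (q i x)) (s : Finset ι)
    {p : V →ₗ[ℂ] W'} (hp : ∀ h x, p (π h x) = τ' h (p x))
    (hker : ∀ x, (∀ i ∈ s, q i x = 0) → p x = 0) :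
    ∃ φ : ι → W →ₗ[ℂ] W', (∀ i h y, φ i (τ i h y) = τ' h (φ i y)) ∧
      p = ∑ i ∈ s, φ i ∘ₗ q i := by
  classical
  induction s using Finset.induction_on generalizing p with
  | empty => exact ⟨0, by simp, LinearMap.ext fun x => by simpa using hker x (by simp)⟩
  | insert k s hk ih =>
    -- It suffices that `p` factors through `q k` on the common kernel of the other maps.
    suffices h : ∃ ψ : W →ₗ[ℂ] W', (∀ h y, ψ (τ k h y) = τ' h (ψ y)) ∧
        ∀ x, (∀ i ∈ s, q i x = 0) → p x = ψ (q k x) by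
      obtain ⟨ψ, hψ, hpψ⟩ := h
      obtain ⟨φ, hφ, hs⟩ := ih (p := p - ψ ∘ₗ q k) (fun h x => by simp [hp, hq, hψ])
        fun x hx => by simp [hpψ x hx]
      refine ⟨Function.update φ k ψ, fun i h y => ?_, ?_⟩
      · rcases eq_or_ne i k with rfl | hi
        · simp [hψ]
        · simp [Function.update_of_ne hi, hφ]
      · rw [Finset.sum_insert hk, Function.update_self, Finset.sum_congr rfl fun i hi => by
          rw [Function.update_of_ne (ne_of_mem_of_not_mem hi hk)], ← hs]
        abel
    let N : Submodule ℂ V := ⨅ i ∈ s, LinearMap.ker (q i)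
    have hN : ∀ x, x ∈ N ↔ ∀ i ∈ s, q i x = 0 := fun x => by simp [N]
    have hNst : ∀ h, ∀ x ∈ N, π h x ∈ N := fun h x hx => by
      rw [hN] at hx ⊢
      exact fun i hi => by rw [hq, hx i hi, map_zero]
    rcases eq_bot_or_eq_top_of_isIrreducible (hτ k) (N.map (q k)) (by
      rintro h _ ⟨x, hx, rfl⟩
      exact ⟨π h x, hNst h x hx, hq k h x⟩) with h0 | h1
    · refine ⟨0, by simp, fun x hx => hker x fun i hi => ?_⟩
      rcases Finset.mem_insert.1 hi with rfl | hi
      · have : q i x ∈ N.map (q i) := ⟨x, (hN x).2 hx, rfl⟩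
        rwa [h0] at this
      · exact hx i hi
    · have hsurj : Function.Surjective (q k ∘ₗ N.subtype) := fun y => by
        obtain ⟨x, hx, rfl⟩ := h1.ge (Submodule.mem_top (x := y))
        exact ⟨⟨x, hx⟩, rfl⟩
      obtain ⟨r, hr⟩ := LinearMap.exists_rightInverse_of_surjective _
        (LinearMap.range_eq_top.2 hsurj)
      have hψ : ∀ x ∈ N, p x = p (r (q k x) : N) := fun x hx => by
        have hr' : q k (r (q k x) : N) = q k x := LinearMap.congr_fun hr (q k x)
        rw [← sub_eq_zero, ← map_sub]
        refine hker _ fun i hi => ?_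
        rcases Finset.mem_insert.1 hi with rfl | hi
        · rw [map_sub, hr', sub_self]
        · exact (hN _).1 (N.sub_mem hx (r (q k x)).2) i hi
      refine ⟨p ∘ₗ N.subtype ∘ₗ r, fun h y => ?_, fun x hx => hψ x ((hN x).2 hx)⟩
      obtain ⟨x, hx, rfl⟩ := h1.ge (Submodule.mem_top (x := y))
      rw [← hq]
      change p (r (q k (π h x)) : N) = τ' h (p (r (q k x) : N))
      rw [← hψ _ (hNst h x hx), ← hψ x hx, hp]

variable {G : Type*} [Group G] {H : Subgroup G}
variable {V : Type*} [AddCommGroup V] [Module ℂ V] {W : Type*} [AddCommGroup W] [Module ℂ W]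

/-- The space `Hom_H(π, τ)`, for a representation `π` of `G` and a representation `τ` of the
subgroup `H`, as a space of linear maps. -/
def homSpace (π : Representation ℂ G V) (τ : Representation ℂ H W) : Submodule ℂ (V →ₗ[ℂ] W) where
  carrier := {p | ∀ (h : H) x, p (π h x) = τ h (p x)}
  zero_mem' := by simp
  add_mem' := fun {a b} ha hb h x => by simp [ha h x, hb h x]
  smul_mem' := fun c a ha h x => by simp [ha h x]

theorem eq_zero_of_forall_apply_eq_zero {π : Representation ℂ G V} (hπ : π.IsIrreducible)
    {p : V →ₗ[ℂ] W} (hp : p ≠ 0) {x : V} (hx : ∀ g, p (π g x) = 0) : x = 0 := by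
  let N : Submodule ℂ V := ⨅ g, LinearMap.ker (p ∘ₗ π g)
  have hN : ∀ x, x ∈ N ↔ ∀ g, p (π g x) = 0 := fun x => by simp [N]
  rcases eq_bot_or_eq_top_of_isIrreducible hπ N (fun g x hx => by
    rw [hN] at hx ⊢
    intro g'
    rw [← Module.End.mul_apply, ← map_mul]
    exact hx _) with h | h
  · rw [← Submodule.mem_bot ℂ, ← h, hN]
    exact hx
  · refine absurd (LinearMap.ext fun y => ?_) hp
    have hy : y ∈ N := h ▸ Submodule.mem_top
    simpa using (hN y).1 hy 1

/-- A space of linear maps `p` from `π` to `τ` is twist stable if it contains `A ∘ p ∘ π g` for all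
`g` and all `H`-equivariant maps `A` from the twist of `τ` by `g` to `τ`. On `Hom_H(π, τ)` these
operations are the projective action of the stabilizer of `τ` in `G`, described without a choice
of the isomorphisms `A`. -/
def TwistStable [H.Normal] (π : Representation ℂ G V) (τ : Representation ℂ H W)
    (P : Submodule ℂ (V →ₗ[ℂ] W)) : Prop :=
  ∀ p ∈ P, ∀ (g : G) (A : W →ₗ[ℂ] W), (∀ h y, A (conjRep τ g h y) = τ h (A y)) →
    A ∘ₗ p ∘ₗ π g ∈ P

theorem apply_rep_rep [H.Normal] {π : Representation ℂ G V} {τ : Representation ℂ H W} {p : V →ₗ[ℂ] W}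
    (hp : p ∈ homSpace π τ) (g : G) (h : H) (x : V) :
    p (π g (π h x)) = conjRep τ g h (p (π g x)) := by
  rw [conjRep_apply, ← hp, ← Module.End.mul_apply, ← Module.End.mul_apply, ← map_mul, ← map_mul]
  simp

theorem comp_rep_mem_homSpace [H.Normal] {π : Representation ℂ G V} {τ : Representation ℂ H W}
    {p : V →ₗ[ℂ] W} (hp : p ∈ homSpace π τ) (g : G) : p ∘ₗ π g ∈ homSpace π (conjRep τ g) :=
  fun h x => apply_rep_rep hp g h x

theorem comp_mem_homSpace {W' : Type*} [AddCommGroup W'] [Module ℂ W'] {π : Representation ℂ G V}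
    {τ : Representation ℂ H W} {τ' : Representation ℂ H W'} {p : V →ₗ[ℂ] W} (hp : p ∈ homSpace π τ)
    {A : W →ₗ[ℂ] W'} (hA : ∀ h y, A (τ h y) = τ' h (A y)) : A ∘ₗ p ∈ homSpace π τ' :=
  fun h x => by simp only [LinearMap.comp_apply]; rw [hp, hA]

section Topology

variable [TopologicalSpace G] [IsTopologicalGroup G]

theorem exists_mem_invariants_apply_eq {π : Representation ℂ G V} (hπ : IsSmooth π) (K : Subgroup G)
    (hK : IsCompact (K : Set G)) {N : Submodule ℂ V} (hN : ∀ k ∈ K, ∀ x ∈ N, π k x ∈ N) {x : V}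
    (hx : x ∈ N) (p : V →ₗ[ℂ] W) (hp : ∀ k ∈ K, p (π k x) = p x) :
    ∃ y ∈ N, y ∈ Representation.invariants (π.comp K.subtype) ∧ p y = p x := by
  obtain ⟨s, hs, hsK, hsx⟩ := exists_sum_mem_invariants hπ K hK (fun _ : Unit => x)
  refine ⟨(s.card : ℂ)⁻¹ • ∑ g ∈ s, π g x,
    N.smul_mem _ (N.sum_mem fun g hg => hN g (hsK g hg) x hx), Submodule.smul_mem _ _ (hsx ()), ?_⟩
  have hc : (s.card : ℂ) ≠ 0 := by exact_mod_cast hs.card_pos.ne'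
  rw [map_smul, map_sum, Finset.sum_congr rfl fun g hg => hp g (hsK g hg), Finset.sum_const,
    ← Nat.cast_smul_eq_nsmul ℂ, smul_smul, inv_mul_cancel₀ hc, one_smul]

theorem apply_eq_zero_of_disjoint_invariants {π : Representation ℂ G V} (hπ : IsSmooth π)
    {τ : Representation ℂ H W} (hτ : τ.IsIrreducible) {K : Subgroup G} (hK : IsCompact (K : Set G))
    (hKH : K ≤ H) {y : W} (hy : y ≠ 0) (hKy : ∀ h : H, (h : G) ∈ K → τ h y = y)
    {N : Submodule ℂ V} (hN : ∀ h : H, ∀ x ∈ N, π h x ∈ N)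
    (hNK : ∀ x ∈ Representation.invariants (π.comp K.subtype), x ∈ N → x = 0)
    {p : V →ₗ[ℂ] W} (hp : p ∈ homSpace π τ) {x : V} (hx : x ∈ N) : p x = 0 := by
  have hpN : N.map p = ⊥ := by
    refine (eq_bot_or_eq_top_of_isIrreducible hτ (N.map p) ?_).resolve_right fun htop => ?_
    · rintro h _ ⟨x, hx, rfl⟩
      exact ⟨π h x, hN h x hx, hp h x⟩
    · obtain ⟨x, hx, hxy⟩ := htop.ge (Submodule.mem_top (x := y))
      obtain ⟨z, hz, hzK, hpz⟩ := exists_mem_invariants_apply_eq hπ K hK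
        (fun k hk x hx => hN ⟨k, hKH hk⟩ x hx) hx p fun k hk => by
          rw [hp ⟨k, hKH hk⟩, hxy, hKy _ hk]
      rw [hNK z hzK hz, map_zero, hxy] at hpz
      exact hy hpz.symm
  have : p x ∈ N.map p := ⟨x, hx, rfl⟩
  rwa [hpN] at this

variable [T2Space G] [LocallyCompactSpace G] [TotallyDisconnectedSpace G]

theorem exists_fixing_subgroup (hH : IsOpen (H : Set G)) {τ : Representation ℂ H W}
    (hτ : IsSmooth τ) (y : W) :
    ∃ K : Subgroup G, IsOpen (K : Set G) ∧ IsCompact (K : Set G) ∧ K ≤ H ∧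
      ∀ h : H, (h : G) ∈ K → τ h y = y := by
  obtain ⟨K, h1, h2, h3⟩ := exists_isOpen_isCompact_subgroup
    (hH.isOpenEmbedding_subtypeVal.isOpenMap _ (hτ y)) ⟨1, by simp, rfl⟩
  refine ⟨K, h1, h2, fun k hk => ?_, fun h hh => ?_⟩
  · obtain ⟨h, -, rfl⟩ := h3 hk
    exact h.2
  · obtain ⟨h', hh', e⟩ := h3 hh
    rwa [← Subtype.ext e]

/-- If a family of linear maps separates the points of a finite-dimensional subspace, then so do
finitely many of its members. -/
theorem exists_finset_forall_imp {ι : Type*} (E : Submodule ℂ V) [FiniteDimensional ℂ E]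
    (q : ι → V →ₗ[ℂ] W) (hq : ∀ x ∈ E, (∀ i, q i x = 0) → x = 0) :
    ∃ s : Finset ι, ∀ x ∈ E, (∀ i ∈ s, q i x = 0) → x = 0 := by
  classical
  let D : Finset ι → Submodule ℂ E := fun s => ⨅ i ∈ s, LinearMap.ker (q i ∘ₗ E.subtype)
  have hD : ∀ s x, x ∈ D s ↔ ∀ i ∈ s, q i x = 0 := fun s x => by simp [D]
  obtain ⟨_, ⟨s, rfl⟩, hs⟩ := (wellFounded_lt (α := Submodule ℂ E)).has_min (Set.range D)
    ⟨_, ∅, rfl⟩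
  refine ⟨s, fun x hx hxs => hq x hx fun i => ?_⟩
  have hle : D (insert i s) ≤ D s := fun y hy => by
    rw [hD] at hy ⊢
    exact fun j hj => hy j (Finset.mem_insert_of_mem hj)
  have heq : D (insert i s) = D s := hle.eq_or_lt.resolve_right (hs _ ⟨_, rfl⟩)
  have hx' : (⟨x, hx⟩ : E) ∈ D (insert i s) := heq ▸ (hD _ _).2 hxs
  exact (hD _ _).1 hx' i (Finset.mem_insert_self i s)

/-- A twist stable subspace `P` of `Hom_H(π, τ)` whose translates by `G` separate the points of
`π` is all of `Hom_H(π, τ)`. For a compact open subgroup `K` that fixes a nonzero vector of `τ`,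
finitely many translates separate the points of the finite-dimensional space of `K`-fixed vectors
of `π`. Their common kernel has no nonzero `K`-fixed vector, so every `p ∈ Hom_H(π, τ)` vanishes on
it and is a combination of these translates. -/
theorem homSpace_le_of_twistStable [H.Normal] {π : Representation ℂ G V} (hπ : IsSmooth π)
    (hadm : IsAdmissible π) (hH : IsOpen (H : Set G)) {τ : Representation ℂ H W}
    (hτ : IsSmoothIrreducible τ) {P : Submodule ℂ (V →ₗ[ℂ] W)} (hP : P ≤ homSpace π τ)
    (hst : TwistStable π τ P) (hker : ∀ x, (∀ p ∈ P, ∀ g, p (π g x) = 0) → x = 0) :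
    homSpace π τ ≤ P := by
  intro p hp
  have := nontrivial_of_isIrreducible hτ.2
  obtain ⟨y, hy⟩ := exists_ne (0 : W)
  obtain ⟨K, hKo, hKc, hKH, hKy⟩ := exists_fixing_subgroup hH hτ.1 y
  have := hadm K hKo hKc
  let q : P × G → V →ₗ[ℂ] W := fun i => i.1.1 ∘ₗ π i.2
  obtain ⟨s, hs⟩ := exists_finset_forall_imp (Representation.invariants (π.comp K.subtype)) q
    fun x _ hx => hker x fun p hp g => hx (⟨p, hp⟩, g)
  have hq : ∀ (i : P × G) (h : H) x, q i (π h x) = conjRep τ i.2 h (q i x) :=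
    fun i h x => apply_rep_rep (hP i.1.2) i.2 h x
  let N : Submodule ℂ V := ⨅ i ∈ s, LinearMap.ker (q i)
  have hN : ∀ x, x ∈ N ↔ ∀ i ∈ s, q i x = 0 := fun x => by simp [N]
  have hNst : ∀ h : H, ∀ x ∈ N, π h x ∈ N := fun h x hx => by
    rw [hN] at hx ⊢
    exact fun i hi => by rw [hq, hx i hi, map_zero]
  have hpq : ∀ x, (∀ i ∈ s, q i x = 0) → p x = 0 := fun x hx =>
    apply_eq_zero_of_disjoint_invariants hπ hτ.2 hKc hKH hy hKy hNst
      (fun x hxK hxN => hs x hxK ((hN x).1 hxN)) hp ((hN x).2 hx)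
  obtain ⟨φ, hφ, hsum⟩ := exists_eq_sum_comp (π := π.comp H.subtype)
    (fun i : P × G => isIrreducible_conjRep hτ.2 i.2) hq s hp hpq
  rw [hsum]
  exact P.sum_mem fun i _ => hst _ i.1.2 i.2 (φ i) (hφ i)

theorem homSpace_le_of_twistStable_of_isIrreducible [H.Normal] {π : Representation ℂ G V}
    (hπ : IsSmoothIrreducible π) (hadm : IsAdmissible π) (hH : IsOpen (H : Set G))
    {τ : Representation ℂ H W} (hτ : IsSmoothIrreducible τ) {P : Submodule ℂ (V →ₗ[ℂ] W)}
    (hP : P ≤ homSpace π τ) (hst : TwistStable π τ P) (h0 : P ≠ ⊥) : homSpace π τ ≤ P := by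
  obtain ⟨p, hp, hp0⟩ := P.ne_bot_iff.1 h0
  exact homSpace_le_of_twistStable hπ.1 hadm hH hτ hP hst
    fun x hx => eq_zero_of_forall_apply_eq_zero hπ.2 hp0 (hx p hp)

theorem finiteDimensional_homSpace {π : Representation ℂ G V} (hπ : IsSmooth π)
    (hadm : IsAdmissible π) (hH : IsOpen (H : Set G)) {τ : Representation ℂ H W}
    (hτ : IsSmoothIrreducible τ) (hadmτ : IsAdmissible τ) :
    FiniteDimensional ℂ (homSpace π τ) := by
  have := nontrivial_of_isIrreducible hτ.2
  obtain ⟨y, hy⟩ := exists_ne (0 : W)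
  obtain ⟨K, hKo, hKc, hKH, hKy⟩ := exists_fixing_subgroup hH hτ.1 y
  have := hadm K hKo hKc
  have hKc' : IsCompact (K.subgroupOf H : Set H) := by
    have := hH.isOpenEmbedding_subtypeVal.isInducing
    refine (H.isClosed_of_isOpen hH).isClosedEmbedding_subtypeVal.isCompact_preimage hKc
  have := hadmτ (K.subgroupOf H) (hKo.preimage continuous_subtype_val) hKc'
  -- An equivariant map is determined by its effect on `K`-fixed vectors.
  let res : homSpace π τ →ₗ[ℂ] (Representation.invariants (π.comp K.subtype) →ₗ[ℂ]
      Representation.invariants (τ.comp (K.subgroupOf H).subtype)) :=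
    { toFun := fun p => p.1.restrict fun x hx k => by
        have := hx ⟨k.1.1, k.2⟩
        have h2 := p.2 k.1 x
        change π k.1.1 x = x at this
        rw [this] at h2
        exact h2.symm
      map_add' := fun _ _ => rfl
      map_smul' := fun _ _ => rfl }
  refine FiniteDimensional.of_injective res ((injective_iff_map_eq_zero res).2 fun p hp => ?_)
  by_contra h0
  obtain ⟨x, hx⟩ := surjective_of_isIrreducible (π := π.comp H.subtype) hτ.2 p.2
    (fun h => h0 (Subtype.ext h)) y
  obtain ⟨z, -, hzK, hpz⟩ := exists_mem_invariants_apply_eq hπ K hKc (N := ⊤) (by simp)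
    (Submodule.mem_top (x := x)) p.1 fun k hk => by rw [p.2 ⟨k, hKH hk⟩, hx, hKy _ hk]
  have h3 : p.1 z = 0 := congrArg Subtype.val (LinearMap.congr_fun hp ⟨z, hzK⟩)
  rw [h3, hx] at hpz
  exact hy hpz.symm

end Topology

end HomSpace

/-! ### Smoothness and admissibility of products -/

section Smooth

variable {G : Type*} [Group G] [TopologicalSpace G]
variable {V : Type*} [AddCommGroup V] [Module ℂ V] {V' : Type*} [AddCommGroup V'] [Module ℂ V']

/-- The stabilizer of a vector, as a subgroup. -/
def vectorStabilizer {G V : Type*} [Group G] [AddCommGroup V] [Module ℂ V]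
    (π : Representation ℂ G V) (x : V) : Subgroup G where
  carrier := {g | π g x = x}
  one_mem' := by simp
  mul_mem' {a b} ha hb := by simp_all
  inv_mem' {a} ha := by
    have := congrArg (π a⁻¹) (show π a x = x from ha)
    simpa using this.symm

theorem IsSmooth.mem_nhds {π : Representation ℂ G V} (hπ : IsSmooth π) (x : V) :
    {g : G | π g x = x} ∈ nhds (1 : G) := (hπ x).mem_nhds (by simp)

theorem IsAdmissible.prod {π : Representation ℂ G V} {π' : Representation ℂ G V'}
    (hπ : IsAdmissible π) (hπ' : IsAdmissible π') : IsAdmissible (π.prod π') := fun K hKo hKc => by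
  have := hπ K hKo hKc
  have := hπ' K hKo hKc
  let f : Representation.invariants ((π.prod π').comp K.subtype) →ₗ[ℂ]
      Representation.invariants (π.comp K.subtype) ×
        Representation.invariants (π'.comp K.subtype) :=
    { toFun := fun x => (⟨x.1.1, fun k => congrArg Prod.fst (x.2 k)⟩,
        ⟨x.1.2, fun k => congrArg Prod.snd (x.2 k)⟩)
      map_add' := fun _ _ => rfl
      map_smul' := fun _ _ => rfl }
  refine FiniteDimensional.of_injective f fun x y h => Subtype.ext (Prod.ext ?_ ?_)
  · exact congrArg (fun z => (z.1 : V)) h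
  · exact congrArg (fun z => (z.2 : V')) h

variable [IsTopologicalGroup G]

theorem isSmooth_of_mem_nhds {π : Representation ℂ G V}
    (h : ∀ x, {g : G | π g x = x} ∈ nhds (1 : G)) : IsSmooth π :=
  fun x => (vectorStabilizer π x).isOpen_of_mem_nhds (g := 1) (h x)

theorem IsSmooth.prod {π : Representation ℂ G V} {π' : Representation ℂ G V'} (hπ : IsSmooth π)
    (hπ' : IsSmooth π') : IsSmooth (π.prod π') :=
  isSmooth_of_mem_nhds fun x => by
    filter_upwards [hπ.mem_nhds x.1, hπ'.mem_nhds x.2] with g h h'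
    exact Prod.ext h h'

theorem IsSmooth.outerTensor {G' : Type*} [Group G'] [TopologicalSpace G'] [IsTopologicalGroup G']
    {π : Representation ℂ G V} {π' : Representation ℂ G' V'} (hπ : IsSmooth π)
    (hπ' : IsSmooth π') : IsSmooth (outerTensor π π') :=
  isSmooth_of_mem_nhds fun x => by
    induction x with
    | zero => simp
    | add x y hx hy =>
      filter_upwards [hx, hy] with g h h'
      rw [map_add, h, h']
    | tmul x y =>
      rw [← Prod.mk_one_one, nhds_prod_eq]
      filter_upwards [Filter.prod_mem_prod (hπ.mem_nhds x) (hπ'.mem_nhds y)] with g h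
      exact congrArg₂ (· ⊗ₜ ·) h.1 h.2

end Smooth

/-! ### Tensor products of irreducible representations -/

section Tensor

variable {V : Type*} [AddCommGroup V] [Module ℂ V] {V' : Type*} [AddCommGroup V'] [Module ℂ V']
variable {W : Type*} [AddCommGroup W] [Module ℂ W] {W' : Type*} [AddCommGroup W'] [Module ℂ W']

theorem eq_zero_of_forall_rTensor_eq_zero {P : Set (V →ₗ[ℂ] W)}
    (hP : ∀ x, (∀ p ∈ P, p x = 0) → x = 0) {t : V ⊗[ℂ] V'}
    (ht : ∀ p ∈ P, p.rTensor V' t = 0) : t = 0 := by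
  let b := Module.Free.chooseBasis ℂ V'
  have key : ∀ (p : V →ₗ[ℂ] W) (t : V ⊗[ℂ] V') k, p (TensorProduct.equivFinsuppOfBasisRight b t k) =
      TensorProduct.equivFinsuppOfBasisRight b (p.rTensor V' t) k := fun p t k => by
    induction t with
    | zero => simp
    | add x y hx hy => simp_all
    | tmul x y => simp
  refine (TensorProduct.equivFinsuppOfBasisRight b).map_eq_zero_iff.1 (Finsupp.ext fun k => ?_)
  exact hP _ fun p hp => by rw [key, ht p hp]; simp

/-- If two families of linear maps separate the points of `V` and of `V'`, then the tensor
products of their members separate the points of `V ⊗ V'`. -/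
theorem eq_zero_of_forall_map_eq_zero {P : Set (V →ₗ[ℂ] W)} {P' : Set (V' →ₗ[ℂ] W')}
    (hP : ∀ x, (∀ p ∈ P, p x = 0) → x = 0) (hP' : ∀ x, (∀ p ∈ P', p x = 0) → x = 0)
    {t : V ⊗[ℂ] V'} (ht : ∀ p ∈ P, ∀ p' ∈ P', TensorProduct.map p p' t = 0) : t = 0 := by
  refine eq_zero_of_forall_rTensor_eq_zero hP fun p hp => ?_
  rw [← (TensorProduct.comm ℂ W V').map_eq_zero_iff]
  refine eq_zero_of_forall_rTensor_eq_zero hP' fun p' hp' => ?_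
  rw [← (TensorProduct.comm ℂ W' W).map_eq_zero_iff, ← ht p hp p' hp']
  clear ht
  induction t with
  | zero => simp
  | add x y hx hy => simp_all
  | tmul x y => simp

variable {G : Type*} [Group G]

/-- Schur's lemma for an admissible smooth irreducible representation: an endomorphism preserves
the finite-dimensional space of `K`-fixed vectors, hence has an eigenvalue. -/
theorem exists_eq_smul_id [TopologicalSpace G] [IsTopologicalGroup G] [T2Space G]
    [LocallyCompactSpace G] [TotallyDisconnectedSpace G] {π : Representation ℂ G V}
    (hπ : IsSmoothIrreducible π) (hadm : IsAdmissible π) {f : V →ₗ[ℂ] V}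
    (hf : ∀ g x, f (π g x) = π g (f x)) : ∃ c : ℂ, f = c • LinearMap.id := by
  have := nontrivial_of_isIrreducible hπ.2
  obtain ⟨y, hy⟩ := exists_ne (0 : V)
  obtain ⟨K, hKo, hKc, hKy⟩ := exists_isOpen_isCompact_subgroup (hπ.1 y) (by simp)
  have := hadm K hKo hKc
  have : Nontrivial (Representation.invariants (π.comp K.subtype)) :=
    ⟨⟨⟨y, fun k => hKy k.2⟩, 0, fun h => hy (congrArg Subtype.val h)⟩⟩
  obtain ⟨c, hc⟩ := Module.End.exists_eigenvalue
    (f.restrict (p := Representation.invariants (π.comp K.subtype))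
      (q := Representation.invariants (π.comp K.subtype)) fun x hx k => by
        have h2 : π k x = x := hx k
        change π k (f x) = f x
        rw [← hf, h2])
  obtain ⟨x, hx⟩ := hc.exists_hasEigenvector
  have hxc : f x = c • (x : V) := congrArg Subtype.val hx.apply_eq_smul
  refine ⟨c, sub_eq_zero.1 ?_⟩
  by_contra h0
  refine hx.2 (Subtype.ext (injective_of_isIrreducible (σ := π) hπ.2 (f := f - c • LinearMap.id)
    (fun g x => by simp [hf]) h0 ?_))
  simp [hxc]

/-- The Jacobson density theorem for an irreducible representation with scalar endomorphisms. -/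
theorem exists_mem_span_range_eq_on {π : Representation ℂ G V} (hπ : π.IsIrreducible)
    (hschur : ∀ f : V →ₗ[ℂ] V, (∀ g x, f (π g x) = π g (f x)) → ∃ c : ℂ, f = c • LinearMap.id)
    (f : V →ₗ[ℂ] V) (s : Finset V) :
    ∃ a ∈ Submodule.span ℂ (Set.range π), ∀ x ∈ s, f x = a x := by
  have : IsSimpleModule (MonoidAlgebra ℂ G) π.asModule :=
    (Representation.irreducible_iff_isSimpleModule_asModule π).1 hπ
  have hend : ∀ φ : Module.End (MonoidAlgebra ℂ G) π.asModule, ∃ c : ℂ, ∀ x, φ x = c • x := by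
    intro φ
    let φ' := (Representation.IntertwiningMap.equivLinearMapAsModule π π).symm φ
    obtain ⟨c, hc⟩ := hschur φ'.toLinearMap fun g x => LinearMap.congr_fun (φ'.isIntertwining' g) x
    exact ⟨c, fun x => LinearMap.congr_fun hc x⟩
  let f' : Module.End (Module.End (MonoidAlgebra ℂ G) π.asModule) π.asModule :=
    { toFun := f
      map_add' := map_add f
      map_smul' := fun φ x => by
        obtain ⟨c, hc⟩ := hend φ
        change f (φ x) = φ (f x)
        rw [hc]
        exact (map_smul f c x).trans (hc (f x)).symm }
  obtain ⟨r, hr⟩ := jacobson_density f' s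
  refine ⟨π.asAlgebraHom r, ?_, fun x hx => hr x hx⟩
  clear hr
  induction r using MonoidAlgebra.induction_linear with
  | zero => simp
  | add x y hx hy =>
    rw [map_add]
    exact Submodule.add_mem _ hx hy
  | single g a =>
    rw [Representation.asAlgebraHom_single]
    exact Submodule.smul_mem _ _ (Submodule.subset_span ⟨g, rfl⟩)

section OuterTensor

variable {G' : Type*} [Group G'] {π : Representation ℂ G V} {π' : Representation ℂ G' V'}

theorem outerTensor_apply (g : G × G') :
    outerTensor π π' g = TensorProduct.map (π g.1) (π' g.2) := rfl

/-- A nonzero subspace of `V ⊗ V'` that is stable under the first factor contains a nonzero pure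
tensor. -/
theorem exists_tmul_mem (hπ : π.IsIrreducible)
    (hschur : ∀ f : V →ₗ[ℂ] V, (∀ g x, f (π g x) = π g (f x)) → ∃ c : ℂ, f = c • LinearMap.id)
    {N : Submodule ℂ (V ⊗[ℂ] V')} (hN : ∀ g, ∀ t ∈ N, (π g).rTensor V' t ∈ N) (h0 : N ≠ ⊥) :
    ∃ x : V, ∃ y : V', x ≠ 0 ∧ y ≠ 0 ∧ x ⊗ₜ[ℂ] y ∈ N := by
  classical
  obtain ⟨t, ht, ht0⟩ := N.ne_bot_iff.1 h0
  let b := Module.Free.chooseBasis ℂ V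
  let c := TensorProduct.equivFinsuppOfBasisLeft (N := V') b t
  have htc : t = c.sum fun i y => b i ⊗ₜ y := by
    rw [← TensorProduct.equivFinsuppOfBasisLeft_symm_apply, LinearEquiv.symm_apply_apply]
  have hc : c ≠ 0 := fun h => ht0 (by rw [htc, h, Finsupp.sum_zero_index])
  obtain ⟨k, hk⟩ := Finsupp.ne_iff.1 hc
  rw [Finsupp.zero_apply] at hk
  obtain ⟨a, ha, hab⟩ := exists_mem_span_range_eq_on hπ hschur
    (b.constr ℂ fun i => if i = k then b k else 0) (c.support.image b)
  refine ⟨b k, c k, b.ne_zero k, hk, ?_⟩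
  have hat : a.rTensor V' t = b k ⊗ₜ c k := by
    conv_lhs => rw [htc, Finsupp.sum, map_sum]
    rw [Finset.sum_eq_single k]
    · rw [LinearMap.rTensor_tmul, ← hab _ (Finset.mem_image_of_mem _ (Finsupp.mem_support_iff.2 hk))]
      simp
    · intro i hi hik
      rw [LinearMap.rTensor_tmul, ← hab _ (Finset.mem_image_of_mem _ hi)]
      simp [hik]
    · intro h
      simp [Finsupp.notMem_support_iff.1 h]
  rw [← hat]
  clear hat hab
  induction ha using Submodule.span_induction with
  | mem a ha =>
    obtain ⟨g, rfl⟩ := ha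
    exact hN g t ht
  | zero => simp
  | add a a' _ _ h h' =>
    rw [LinearMap.rTensor_add]
    exact N.add_mem h h'
  | smul r a _ h =>
    rw [LinearMap.rTensor_smul]
    exact N.smul_mem r h

theorem isIrreducible_outerTensor (hπ : π.IsIrreducible)
    (hschur : ∀ f : V →ₗ[ℂ] V, (∀ g x, f (π g x) = π g (f x)) → ∃ c : ℂ, f = c • LinearMap.id)
    (hπ' : π'.IsIrreducible) : (outerTensor π π').IsIrreducible := by
  have := nontrivial_of_isIrreducible hπ
  have := nontrivial_of_isIrreducible hπ'
  refine isIrreducible_of_forall fun N hN => or_iff_not_imp_left.2 fun h0 => ?_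
  have h1 : ∀ g, ∀ t ∈ N, (π g).rTensor V' t ∈ N := fun g t ht => by
    have := hN (g, 1) t ht
    rwa [outerTensor_apply, map_one] at this
  have h2 : ∀ g, ∀ t ∈ N, (π' g).lTensor V t ∈ N := fun g t ht => by
    have := hN (1, g) t ht
    rwa [outerTensor_apply, map_one] at this
  obtain ⟨x, y, hx, hy, hxy⟩ := exists_tmul_mem hπ hschur h1 h0
  have key : ∀ x', x' ⊗ₜ[ℂ] y ∈ N := fun x' => by
    have := (eq_bot_or_eq_top_of_isIrreducible hπ (N.comap ((TensorProduct.mk ℂ V V').flip y))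
      fun g z hz => h1 g _ hz).resolve_left fun h => hx ?_
    · exact this.ge (Submodule.mem_top (x := x'))
    · rw [← Submodule.mem_bot ℂ, ← h]
      exact hxy
  refine (Submodule.eq_top_iff').2 fun t => ?_
  induction t with
  | zero => exact N.zero_mem
  | add s t hs ht => exact N.add_mem hs ht
  | tmul x' y' =>
    have := (eq_bot_or_eq_top_of_isIrreducible hπ' (N.comap (TensorProduct.mk ℂ V V' x'))
      fun g z hz => h2 g _ hz).resolve_left fun h => hy ?_
    · exact this.ge (Submodule.mem_top (x := y'))
    · rw [← Submodule.mem_bot ℂ, ← h]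
      exact key x'

/-- If a tensor product is irreducible, then so is its second factor: for a subspace `M` of `V'`,
the tensors all of whose contractions with linear forms on `V` lie in `M` form a stable subspace. -/
theorem isIrreducible_of_isIrreducible_outerTensor [Nontrivial V]
    (h : (outerTensor π π').IsIrreducible) : π'.IsIrreducible := by
  have : Nontrivial V' := by
    by_contra hV'
    rw [not_nontrivial_iff_subsingleton] at hV'
    have := nontrivial_of_isIrreducible h
    exact not_subsingleton (V ⊗[ℂ] V') inferInstance
  refine isIrreducible_of_forall fun M hM => or_iff_not_imp_left.2 fun h0 => ?_
  obtain ⟨x, hx⟩ := exists_ne (0 : V)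
  obtain ⟨φ, hφ⟩ := Module.Projective.exists_dual_eq_one ℂ hx
  obtain ⟨m, hm, hm0⟩ := M.ne_bot_iff.1 h0
  let c : (V →ₗ[ℂ] ℂ) → V ⊗[ℂ] V' →ₗ[ℂ] V' := fun ψ => TensorProduct.lid ℂ V' ∘ₗ ψ.rTensor V'
  have hc : ∀ ψ x y, c ψ (x ⊗ₜ y) = ψ x • y := fun ψ x y => by simp [c]
  have hcg : ∀ ψ g t, c ψ (outerTensor π π' g t) = π' g.2 (c (ψ ∘ₗ π g.1) t) := fun ψ g t => by
    induction t with
    | zero => simp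
    | add s t hs ht => simp only [map_add, hs, ht]
    | tmul x y => rw [outerTensor_apply, TensorProduct.map_tmul, hc, hc, map_smul]; rfl
  let N : Submodule ℂ (V ⊗[ℂ] V') := ⨅ ψ, M.comap (c ψ)
  have hN : ∀ t, t ∈ N ↔ ∀ ψ, c ψ t ∈ M := fun t => by simp [N]
  have hNtop : N = ⊤ := by
    refine (eq_bot_or_eq_top_of_isIrreducible h N fun g t ht => ?_).resolve_left fun hbot => ?_
    · rw [hN] at ht ⊢
      exact fun ψ => by rw [hcg]; exact hM _ _ (ht _)
    · have hxm : x ⊗ₜ[ℂ] m ∈ N := (hN _).2 fun ψ => by rw [hc]; exact M.smul_mem _ hm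
      rw [hbot, Submodule.mem_bot] at hxm
      have := hc φ x m
      rw [hxm, hφ, map_zero, one_smul] at this
      exact hm0 this.symm
  refine Submodule.eq_top_iff'.2 fun y => ?_
  have := (hN (x ⊗ₜ y)).1 (hNtop ▸ Submodule.mem_top) φ
  rwa [hc, hφ, one_smul] at this

end OuterTensor

end Tensor

/-! ### Irreducible representations of a product -/

section Factorization

variable {G₁ G₂ : Type*} [Group G₁] [Group G₂]
variable {W : Type v} [AddCommGroup W] [Module ℂ W] {σ : Representation ℂ (G₁ × G₂) W}

theorem apply_inl_inr (σ : Representation ℂ (G₁ × G₂) W) (a : G₁) (b : G₂) (x : W) :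
    σ (a, 1) (σ (1, b) x) = σ (a, b) x := by
  rw [← Module.End.mul_apply, ← map_mul, Prod.mk_mul_mk, mul_one, one_mul]

theorem apply_inr_inl (σ : Representation ℂ (G₁ × G₂) W) (a : G₁) (b : G₂) (x : W) :
    σ (1, b) (σ (a, 1) x) = σ (a, b) x := by
  rw [← Module.End.mul_apply, ← map_mul, Prod.mk_mul_mk, mul_one, one_mul]

/-- The representation of `G₂` on `Hom_{G₁}(π, σ)`, for a representation `σ` of `G₁ × G₂`. -/
noncomputable def multiplicityRep {Y : Type*} [AddCommGroup Y] [Module ℂ Y]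
    (π : Representation ℂ G₁ Y) (σ : Representation ℂ (G₁ × G₂) W) :
    Representation ℂ G₂ (π.IntertwiningMap (σ.comp (MonoidHom.inl G₁ G₂))) where
  toFun b :=
    { toFun := fun m => ⟨σ (1, b) ∘ₗ m.toLinearMap, fun a => LinearMap.ext fun x => by
        have := LinearMap.congr_fun (m.isIntertwining' a) x
        change m.toLinearMap (π a x) = σ (a, 1) (m.toLinearMap x) at this
        change σ (1, b) (m.toLinearMap (π a x)) = σ (a, 1) (σ (1, b) (m.toLinearMap x))
        rw [this, apply_inl_inr, apply_inr_inl]⟩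
      map_add' := fun m m' => by ext x; exact map_add (σ (1, b)) (m x) (m' x)
      map_smul' := fun c m => by ext x; exact map_smul (σ (1, b)) c (m x) }
  map_one' := by
    ext m x
    change σ (1, 1) (m x) = m x
    rw [← Prod.one_eq_mk, map_one]
    rfl
  map_mul' b b' := by
    ext m x
    change σ (1, b * b') (m x) = σ (1, b) (σ (1, b') (m x))
    rw [← Module.End.mul_apply, ← map_mul, Prod.mk_mul_mk, mul_one]

theorem multiplicityRep_apply {Y : Type*} [AddCommGroup Y] [Module ℂ Y]
    (π : Representation ℂ G₁ Y) (σ : Representation ℂ (G₁ × G₂) W) (b : G₂)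
    (m : π.IntertwiningMap (σ.comp (MonoidHom.inl G₁ G₂))) (x : Y) :
    multiplicityRep π σ b m x = σ (1, b) (m x) := rfl

variable [TopologicalSpace G₁] [IsTopologicalGroup G₁]

/-- If an irreducible representation of `G₁ × G₂` has a nonzero vector fixed by a compact subgroup
`K` of `G₁`, then so does every nonzero subspace that is stable under `G₁`. -/
theorem exists_mem_invariants_of_ne_bot (hσ : σ.IsIrreducible)
    (hs : IsSmooth (σ.comp (MonoidHom.inl G₁ G₂))) {K : Subgroup G₁} (hK : IsCompact (K : Set G₁))
    {y : W} (hy0 : y ≠ 0) (hy : ∀ k ∈ K, σ (k, 1) y = y) {N : Submodule ℂ W}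
    (hN : ∀ g : G₁, ∀ x ∈ N, σ (g, 1) x ∈ N) (h0 : N ≠ ⊥) :
    ∃ x ∈ N, x ≠ 0 ∧ ∀ k ∈ K, σ (k, 1) x = x := by
  by_contra! hcon
  -- The translates of `N` by `G₂` span everything, in particular `y`, and none of them has a
  -- nonzero vector fixed by `K`.
  let T : Submodule ℂ W := ⨆ b : G₂, N.map (σ (1, b))
  have hT : T = ⊤ := by
    refine (eq_bot_or_eq_top_of_isIrreducible hσ T ?_).resolve_left fun h => h0 ?_
    · rintro ⟨a, b⟩ x hx
      induction hx using Submodule.iSup_induction' with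
      | mem b' x hx =>
        obtain ⟨z, hz, rfl⟩ := hx
        refine Submodule.mem_iSup_of_mem (b * b') ⟨σ (a, 1) z, hN a z hz, ?_⟩
        rw [apply_inr_inl, ← Module.End.mul_apply, ← map_mul, Prod.mk_mul_mk, mul_one]
      | zero => simp
      | add x x' _ _ h h' => rw [map_add]; exact T.add_mem h h'
    · have := le_iSup (fun b : G₂ => N.map (σ (1, b))) 1
      refine le_bot_iff.1 (le_trans (fun x hx => ?_) (this.trans h.le))
      exact ⟨x, hx, by rw [← Prod.one_eq_mk, map_one]; rfl⟩
  obtain ⟨f, hf, hfy⟩ := (Submodule.mem_iSup_iff_exists_finsupp _ _).1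
    (hT.ge (Submodule.mem_top (x := y)))
  choose z hz hzf using hf
  obtain ⟨s, hs, hsK, hsf⟩ := exists_sum_mem_invariants hs K hK (fun i : f.support => z i)
  have hzero : ∀ i ∈ f.support, ∑ g ∈ s, σ (g, 1) (f i) = 0 := fun i hi => by
    have h1 : ∑ g ∈ s, σ (g, 1) (z i) = 0 := by
      by_contra hne
      obtain ⟨k, hk, hk'⟩ := hcon _ (N.sum_mem fun g _ => hN g _ (hz i)) hne
      exact hk' (hsf ⟨i, hi⟩ ⟨k, hk⟩)
    have h2 : ∀ g, σ (g, 1) (f i) = σ (1, i) (σ (g, 1) (z i)) := fun g => by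
      rw [← hzf, apply_inl_inr, apply_inr_inl]
    rw [Finset.sum_congr rfl fun g _ => h2 g, ← map_sum, h1, map_zero]
  have hc : (s.card : ℂ) ≠ 0 := by exact_mod_cast hs.card_pos.ne'
  refine hy0 ((smul_eq_zero.1 ?_).resolve_left hc)
  have h2 : ∑ g ∈ s, σ (g, 1) y = (s.card : ℂ) • y := by
    rw [Finset.sum_congr rfl fun g hg => hy g (hsK g hg), Finset.sum_const, Nat.cast_smul_eq_nsmul]
  rw [← h2, ← hfy, Finsupp.sum]
  simp_rw [map_sum]
  rw [Finset.sum_comm]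
  exact Finset.sum_eq_zero hzero

variable [TopologicalSpace G₂] [IsTopologicalGroup G₂]
  [T2Space G₁] [LocallyCompactSpace G₁] [TotallyDisconnectedSpace G₁]
  [T2Space G₂] [LocallyCompactSpace G₂] [TotallyDisconnectedSpace G₂]

/-- The restriction to `G₁` of an admissible irreducible representation of `G₁ × G₂` contains an
irreducible representation: a vector fixed by `K₁` generates one if it lies in a subspace of
`K₂`-fixed vectors that is stable under `G₁` and has the smallest possible nonzero space of
`K₁`-fixed vectors. -/
theorem exists_irreducible_subspace (hσ : IsSmoothIrreducible σ) (hadm : IsAdmissible σ) :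
    ∃ (Y : Submodule ℂ W) (hY : ∀ g, Y ≤ Y.comap (σ.comp (MonoidHom.inl G₁ G₂) g)),
      (Representation.subrepresentation (σ.comp (MonoidHom.inl G₁ G₂)) Y hY).IsIrreducible := by
  have := nontrivial_of_isIrreducible hσ.2
  obtain ⟨y, hy⟩ := exists_ne (0 : W)
  obtain ⟨U₁, U₂, hU₁, hU₂, h1, h2, hU⟩ := isOpen_prod_iff.1 (hσ.1 y) 1 1
    (by rw [← Prod.one_eq_mk, Set.mem_ofPred_eq, map_one]; rfl)
  obtain ⟨K₁, hK₁o, hK₁c, hK₁⟩ := exists_isOpen_isCompact_subgroup hU₁ h1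
  obtain ⟨K₂, hK₂o, hK₂c, hK₂⟩ := exists_isOpen_isCompact_subgroup hU₂ h2
  have hyK : ∀ a ∈ K₁, ∀ b ∈ K₂, σ (a, b) y = y := fun a ha b hb => hU ⟨hK₁ ha, hK₂ hb⟩
  have hy₁ : ∀ k ∈ K₁, σ (k, 1) y = y := fun k hk => hyK k hk 1 K₂.one_mem
  have hs : IsSmooth (σ.comp (MonoidHom.inl G₁ G₂)) := fun x =>
    (hσ.1 x).preimage (by fun_prop : Continuous fun a : G₁ => (a, (1 : G₂)))
  let F : Submodule ℂ W := Representation.invariants (σ.comp (K₁.prod K₂).subtype)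
  have hF : ∀ x, x ∈ F ↔ ∀ a ∈ K₁, ∀ b ∈ K₂, σ (a, b) x = x := fun x =>
    ⟨fun h a ha b hb => h ⟨(a, b), ha, hb⟩, fun h k => h _ k.2.1 _ k.2.2⟩
  have hfin : FiniteDimensional ℂ F :=
    hadm (K₁.prod K₂) (by rw [Subgroup.coe_prod]; exact hK₁o.prod hK₂o)
      (by rw [Subgroup.coe_prod]; exact hK₁c.prod hK₂c)
  let S : Set (Submodule ℂ W) := {N | (∀ g : G₁, ∀ x ∈ N, σ (g, 1) x ∈ N) ∧
    (∀ x ∈ N, ∀ b ∈ K₂, σ (1, b) x = x) ∧ N ≠ ⊥}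
  let N₀ : Submodule ℂ W :=
    Representation.invariants ((σ.comp (MonoidHom.inr G₁ G₂)).comp K₂.subtype)
  have hS : N₀ ∈ S := by
    refine ⟨fun g x hx b => ?_, fun x hx b hb => hx ⟨b, hb⟩, fun h => hy ?_⟩
    · change σ (1, b) (σ (g, 1) x) = σ (g, 1) x
      rw [apply_inr_inl, ← apply_inl_inr]
      exact congrArg _ (hx b)
    · rw [← Submodule.mem_bot ℂ, ← h]
      exact fun b => hyK 1 K₁.one_mem b b.2
  obtain ⟨N, ⟨hN₁, hN₂, hN0⟩, hmin⟩ := (measure fun N : Submodule ℂ W =>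
    Module.finrank ℂ (N ⊓ F : Submodule ℂ W)).wf.has_min S ⟨_, hS⟩
  obtain ⟨z, hzN, hz0, hzK⟩ := exists_mem_invariants_of_ne_bot hσ.2 hs hK₁c hy hy₁ hN₁ hN0
  have hzF : z ∈ F := (hF z).2 fun a ha b hb => by
    rw [← apply_inl_inr, hN₂ z hzN b hb, hzK a ha]
  -- By minimality, `z` lies in every nonzero stable subspace of `N`.
  have hmem : ∀ Z ≤ N, (∀ g : G₁, ∀ x ∈ Z, σ (g, 1) x ∈ Z) → Z ≠ ⊥ → z ∈ Z := fun Z hZ hZ₁ hZ0 => by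
    have hle : Z ⊓ F ≤ N ⊓ F := inf_le_inf_right F hZ
    have hnot := hmin Z ⟨hZ₁, fun x hx => hN₂ x (hZ hx), hZ0⟩
    have : FiniteDimensional ℂ (N ⊓ F : Submodule ℂ W) := Submodule.finiteDimensional_inf_right N F
    have heq := Submodule.eq_of_le_of_finrank_le hle (not_lt.1 hnot)
    exact (heq.ge ⟨hzN, hzF⟩).1
  let Y : Submodule ℂ W := Submodule.span ℂ (Set.range fun g : G₁ => σ (g, 1) z)
  have hYN : Y ≤ N := Submodule.span_le.2 (by rintro _ ⟨g, rfl⟩; exact hN₁ g z hzN)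
  have hzY : z ∈ Y := Submodule.subset_span ⟨1, by
    change σ (1, 1) z = z
    rw [← Prod.one_eq_mk, map_one]; rfl⟩
  have hY : ∀ g : G₁, Y ≤ Y.comap (σ.comp (MonoidHom.inl G₁ G₂) g) := fun g => by
    refine Submodule.span_le.2 ?_
    rintro _ ⟨g', rfl⟩
    refine Submodule.subset_span ⟨g * g', ?_⟩
    change _ = σ (g, 1) (σ (g', 1) z)
    rw [← Module.End.mul_apply, ← map_mul, Prod.mk_mul_mk, mul_one]
  refine ⟨Y, hY, ?_⟩
  have : Nontrivial Y := ⟨⟨⟨z, hzY⟩, 0, fun h => hz0 (congrArg Subtype.val h)⟩⟩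
  refine isIrreducible_of_forall fun M hM => or_iff_not_imp_left.2 fun hM0 => ?_
  have hZ : ∀ g : G₁, ∀ x ∈ M.map Y.subtype, σ (g, 1) x ∈ M.map Y.subtype := by
    rintro g _ ⟨x, hx, rfl⟩
    exact ⟨_, hM g x hx, rfl⟩
  have hz := hmem (M.map Y.subtype) ((Submodule.map_subtype_le Y M).trans hYN) hZ
    fun h => hM0 (Submodule.map_injective_of_injective Y.injective_subtype
      (h.trans (Submodule.map_bot _).symm))
  have hYM : Y ≤ M.map Y.subtype :=
    Submodule.span_le.2 (by rintro _ ⟨g, rfl⟩; exact hZ g z hz)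
  refine Submodule.eq_top_iff'.2 fun x => ?_
  obtain ⟨x', hx', e⟩ := hYM x.2
  rwa [← Subtype.ext e]

/-- An admissible smooth irreducible representation `σ` of `G₁ × G₂` is a tensor product
`π₁ ⊗ π₂`: here `π₁` is an irreducible subrepresentation of the restriction of `σ` to `G₁`, and
`π₂` is `Hom_{G₁}(π₁, σ)`. -/
theorem exists_equiv_outerTensor (hσ : IsSmoothIrreducible σ) (hadm : IsAdmissible σ)
    (hadm₁ : IrreduciblesAdmissible.{_, v} G₁) :
    ∃ (V₁ V₂ : Type v) (_ : AddCommGroup V₁) (_ : Module ℂ V₁) (_ : AddCommGroup V₂)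
      (_ : Module ℂ V₂) (π₁ : Representation ℂ G₁ V₁) (π₂ : Representation ℂ G₂ V₂),
      IsSmoothIrreducible π₁ ∧ IsSmoothIrreducible π₂ ∧
        Nonempty (σ.Equiv (outerTensor π₁ π₂)) := by
  obtain ⟨Y, hY, hirr⟩ := exists_irreducible_subspace hσ hadm
  have hs : IsSmooth (σ.comp (MonoidHom.inl G₁ G₂)) := fun x =>
    (hσ.1 x).preimage (by fun_prop : Continuous fun a : G₁ => (a, (1 : G₂)))
  set π₁ := Representation.subrepresentation (σ.comp (MonoidHom.inl G₁ G₂)) Y hY with hπ₁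
  have hπ₁s : IsSmoothIrreducible π₁ := ⟨fun x => by
    convert hs x.1 using 2
    ext g
    exact Subtype.ext_iff, hirr⟩
  have hschur : ∀ f : Y →ₗ[ℂ] Y, (∀ g x, f (π₁ g x) = π₁ g (f x)) → ∃ c : ℂ, f = c • LinearMap.id :=
    fun f hf => exists_eq_smul_id hπ₁s (hadm₁ Y π₁ hπ₁s) hf
  let π₂ := multiplicityRep π₁ σ
  have := nontrivial_of_isIrreducible hirr
  obtain ⟨y, hy⟩ := exists_ne (0 : Y)
  have hinj : ∀ m : π₁.IntertwiningMap (σ.comp (MonoidHom.inl G₁ G₂)), m y = 0 → m = 0 :=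
    fun m hm => by
      by_contra h0
      exact hy (injective_of_isIrreducible hirr (f := m.toLinearMap)
        (fun g x => LinearMap.congr_fun (m.isIntertwining' g) x)
        (fun h => h0 (Representation.IntertwiningMap.ext h)) (hm.trans (map_zero _).symm))
  let ev : Y ⊗[ℂ] π₁.IntertwiningMap (σ.comp (MonoidHom.inl G₁ G₂)) →ₗ[ℂ] W :=
    TensorProduct.lift (LinearMap.flip
      { toFun := fun m => m.toLinearMap, map_add' := fun _ _ => rfl, map_smul' := fun _ _ => rfl })
  have hev : ∀ x m, ev (x ⊗ₜ m) = m x := fun x m => rfl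
  have heq : ∀ g t, ev (outerTensor π₁ π₂ g t) = σ g (ev t) := fun g t => by
    induction t with
    | zero => simp
    | add s t hs ht => rw [map_add, map_add, hs, ht, map_add, map_add]
    | tmul x m =>
      rw [outerTensor_apply, TensorProduct.map_tmul, hev, hev, multiplicityRep_apply]
      have := LinearMap.congr_fun (m.isIntertwining' g.1) x
      change m (π₁ g.1 x) = σ (g.1, 1) (m x) at this
      rw [this, apply_inr_inl]
  have hevinj : Function.Injective ev := by
    rw [← LinearMap.ker_eq_bot]
    by_contra hne
    obtain ⟨x, m, hx, hm, hxm⟩ := exists_tmul_mem hirr hschur (N := LinearMap.ker ev)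
      (fun g t ht => by
        have := heq (g, 1) t
        rw [outerTensor_apply, map_one, LinearMap.mem_ker.1 ht, map_zero] at this
        exact this) hne
    refine hx (injective_of_isIrreducible hirr (f := m.toLinearMap)
        (fun g x => LinearMap.congr_fun (m.isIntertwining' g) x)
        (fun h => hm (Representation.IntertwiningMap.ext h)) (Eq.trans ?_ (map_zero _).symm))
    exact hxm
  have hevsurj : Function.Surjective ev := by
    refine surjective_of_isIrreducible hσ.2 heq fun h => hy ?_
    have := LinearMap.congr_fun h (y ⊗ₜ ⟨Y.subtype, fun g => rfl⟩)
    exact Subtype.ext this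
  obtain ⟨e⟩ := exists_equiv_of_bijective heq ⟨hevinj, hevsurj⟩
  have hirr₂ : π₂.IsIrreducible := by
    refine isIrreducible_of_isIrreducible_outerTensor (π := π₁) ?_
    have : Nontrivial (Y ⊗[ℂ] π₁.IntertwiningMap (σ.comp (MonoidHom.inl G₁ G₂))) :=
      have := nontrivial_of_isIrreducible hσ.2
      hevsurj.nontrivial
    refine isIrreducible_of_forall fun N hN => ?_
    rcases eq_bot_or_eq_top_of_isIrreducible hσ.2 (N.map ev) (by
      rintro g _ ⟨t, ht, rfl⟩
      exact ⟨_, hN g t ht, heq g t⟩) with h | h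
    · exact Or.inl (Submodule.map_injective_of_injective hevinj (h.trans (Submodule.map_bot _).symm))
    · right
      rw [← Submodule.comap_map_eq_of_injective hevinj N, h, Submodule.comap_top]
  refine ⟨Y, _, _, _, _, _, π₁, π₂, hπ₁s, ⟨fun m => ?_, hirr₂⟩, ⟨e.symm⟩⟩
  -- An intertwining map is determined by its value at `y`.
  convert (hσ.1 (m y)).preimage (by fun_prop : Continuous fun b : G₂ => ((1 : G₁), b)) using 1
  ext b
  refine ⟨fun h => DFunLike.congr_fun (show π₂ b m = m from h) y, fun h => ?_⟩
  rw [Set.mem_ofPred_eq, ← sub_eq_zero]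
  refine hinj _ ?_
  rw [Representation.IntertwiningMap.coe_sub, Pi.sub_apply, multiplicityRep_apply, sub_eq_zero]
  exact h

end Factorization

/-! ### Representations of a fibre product -/

section Graph

/-- The structure used of the group `Γ = graphSubgroup γ`: surjective projections to `G₁` and `G₂`
that are jointly injective, and a copy of `H₁ × H₂` on which they are the inclusions. Unlike
`graphSubgroup γ` it can be mirrored by swapping the two factors. -/
structure GraphDatum (Γ : Type*) [Group Γ] {G₁ G₂ : Type*} [Group G₁] [Group G₂] (H₁ : Subgroup G₁)
    (H₂ : Subgroup G₂) where
  /-- The first projection. -/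
  fst : Γ →* G₁
  /-- The second projection. -/
  snd : Γ →* G₂
  /-- The inclusion of `H₁ × H₂`. -/
  incl : H₁ × H₂ →* Γ
  fst_surjective : Function.Surjective fst
  snd_surjective : Function.Surjective snd
  fst_incl : ∀ h, fst (incl h) = h.1
  snd_incl : ∀ h, snd (incl h) = h.2
  ext : ∀ ⦃a b⦄, fst a = fst b → snd a = snd b → a = b

variable {Γ : Type*} [Group Γ] {G₁ G₂ : Type*} [Group G₁] [Group G₂] {H₁ : Subgroup G₁}
  {H₂ : Subgroup G₂}

namespace GraphDatum

/-- The datum with the two factors exchanged. -/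
def swap (D : GraphDatum Γ H₁ H₂) : GraphDatum Γ H₂ H₁ where
  fst := D.snd
  snd := D.fst
  incl := D.incl.comp (MulEquiv.prodComm : H₂ × H₁ ≃* H₁ × H₂).toMonoidHom
  fst_surjective := D.snd_surjective
  snd_surjective := D.fst_surjective
  fst_incl _ := D.snd_incl _
  snd_incl _ := D.fst_incl _
  ext _ _ h h' := D.ext h' h

variable (D : GraphDatum Γ H₁ H₂)
variable {V : Type*} [AddCommGroup V] [Module ℂ V] (ρ : Representation ℂ Γ V)

/-- The space `Hom_{H₁ × H₂}(ρ, τ₁ ⊗ τ₂)`. -/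
def restrictedHom {W₁ W₂ : Type*} [AddCommGroup W₁] [Module ℂ W₁] [AddCommGroup W₂] [Module ℂ W₂]
    (τ₁ : Representation ℂ H₁ W₁) (τ₂ : Representation ℂ H₂ W₂) :
    Submodule ℂ (V →ₗ[ℂ] W₁ ⊗[ℂ] W₂) where
  carrier := {l | ∀ h x, l (ρ (D.incl h) x) = TensorProduct.map (τ₁ h.1) (τ₂ h.2) (l x)}
  zero_mem' := by simp
  add_mem' := fun {a b} ha hb h x => by simp only [LinearMap.add_apply, ha h x, hb h x, map_add]
  smul_mem' := fun c a ha h x => by simp only [LinearMap.smul_apply, ha h x, map_smul]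

/-- The space `Hom_Γ(ρ, π₁ ⊗ π₂)`. -/
def graphHom {V₁ V₂ : Type*} [AddCommGroup V₁] [Module ℂ V₁] [AddCommGroup V₂] [Module ℂ V₂]
    (π₁ : Representation ℂ G₁ V₁) (π₂ : Representation ℂ G₂ V₂) :
    Submodule ℂ (V →ₗ[ℂ] V₁ ⊗[ℂ] V₂) where
  carrier := {f | ∀ a x, f (ρ a x) = TensorProduct.map (π₁ (D.fst a)) (π₂ (D.snd a)) (f x)}
  zero_mem' := by simp
  add_mem' := fun {a b} ha hb h x => by simp only [LinearMap.add_apply, ha h x, hb h x, map_add]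
  smul_mem' := fun c a ha h x => by simp only [LinearMap.smul_apply, ha h x, map_smul]

/-- The restriction of `ρ` to `H₁ × H₂` is a theta representation, in terms of the spaces
`Hom_{H₁ × H₂}(ρ, τ₁ ⊗ τ₂)` for irreducible smooth `τ₁` and `τ₂`. -/
structure IsThetaOn [TopologicalSpace G₁] [TopologicalSpace G₂] : Prop where
  snd_equiv : ∀ (W₁ W₂ W₂' : Type v) [AddCommGroup W₁] [Module ℂ W₁] [AddCommGroup W₂]
    [Module ℂ W₂] [AddCommGroup W₂'] [Module ℂ W₂'] (τ₁ : Representation ℂ H₁ W₁)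
    (τ₂ : Representation ℂ H₂ W₂) (τ₂' : Representation ℂ H₂ W₂'), IsSmoothIrreducible τ₁ →
    IsSmoothIrreducible τ₂ → IsSmoothIrreducible τ₂' → D.restrictedHom ρ τ₁ τ₂ ≠ ⊥ →
    D.restrictedHom ρ τ₁ τ₂' ≠ ⊥ → Nonempty (τ₂.Equiv τ₂')
  fst_equiv : ∀ (W₁ W₁' W₂ : Type v) [AddCommGroup W₁] [Module ℂ W₁] [AddCommGroup W₁']
    [Module ℂ W₁'] [AddCommGroup W₂] [Module ℂ W₂] (τ₁ : Representation ℂ H₁ W₁)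
    (τ₁' : Representation ℂ H₁ W₁') (τ₂ : Representation ℂ H₂ W₂), IsSmoothIrreducible τ₁ →
    IsSmoothIrreducible τ₁' → IsSmoothIrreducible τ₂ → D.restrictedHom ρ τ₁ τ₂ ≠ ⊥ →
    D.restrictedHom ρ τ₁' τ₂ ≠ ⊥ → Nonempty (τ₁.Equiv τ₁')
  exists_smul_eq : ∀ (W₁ W₂ : Type v) [AddCommGroup W₁] [Module ℂ W₁] [AddCommGroup W₂]
    [Module ℂ W₂] (τ₁ : Representation ℂ H₁ W₁) (τ₂ : Representation ℂ H₂ W₂),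
    IsSmoothIrreducible τ₁ → IsSmoothIrreducible τ₂ → ∀ l ∈ D.restrictedHom ρ τ₁ τ₂,
    ∀ l' ∈ D.restrictedHom ρ τ₁ τ₂, l ≠ 0 → ∃ c : ℂ, c • l = l'

variable {D ρ}

section Algebra

theorem comm_map {V₁ V₂ W₁ W₂ : Type*} [AddCommGroup V₁] [Module ℂ V₁] [AddCommGroup V₂]
    [Module ℂ V₂] [AddCommGroup W₁] [Module ℂ W₁] [AddCommGroup W₂] [Module ℂ W₂]
    (p₁ : V₁ →ₗ[ℂ] W₁) (p₂ : V₂ →ₗ[ℂ] W₂) (t : V₁ ⊗[ℂ] V₂) :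
    TensorProduct.map p₂ p₁ (TensorProduct.comm ℂ V₁ V₂ t) =
      TensorProduct.comm ℂ W₁ W₂ (TensorProduct.map p₁ p₂ t) := by
  induction t with
  | zero => simp
  | add s t hs ht => simp only [map_add, hs, ht]
  | tmul x y => rfl

variable {V₁ V₂ W₁ W₂ : Type*} [AddCommGroup V₁] [Module ℂ V₁] [AddCommGroup V₂] [Module ℂ V₂]
  [AddCommGroup W₁] [Module ℂ W₁] [AddCommGroup W₂] [Module ℂ W₂]
  {π₁ : Representation ℂ G₁ V₁} {π₂ : Representation ℂ G₂ V₂}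
  {τ₁ : Representation ℂ H₁ W₁} {τ₂ : Representation ℂ H₂ W₂}

theorem comm_comp_mem_restrictedHom {l : V →ₗ[ℂ] W₂ ⊗[ℂ] W₁}
    (hl : l ∈ D.swap.restrictedHom ρ τ₂ τ₁) :
    (TensorProduct.comm ℂ W₂ W₁).toLinearMap ∘ₗ l ∈ D.restrictedHom ρ τ₁ τ₂ := fun h x => by
  have := hl (h.2, h.1) x
  change l (ρ (D.incl h) x) = _ at this
  rw [LinearMap.comp_apply, this]
  exact (comm_map _ _ _).symm

theorem comm_comp_mem_graphHom {f : V →ₗ[ℂ] V₁ ⊗[ℂ] V₂} (hf : f ∈ D.graphHom ρ π₁ π₂) :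
    (TensorProduct.comm ℂ V₁ V₂).toLinearMap ∘ₗ f ∈ D.swap.graphHom ρ π₂ π₁ := fun a x => by
  rw [LinearMap.comp_apply, hf a x]
  exact (comm_map _ _ _).symm

theorem comm_comp_eq_zero {U : Type*} [AddCommGroup U] [Module ℂ U] {l : U →ₗ[ℂ] V₁ ⊗[ℂ] V₂}
    (h : (TensorProduct.comm ℂ V₁ V₂).toLinearMap ∘ₗ l = 0) : l = 0 :=
  LinearMap.ext fun x => (TensorProduct.comm ℂ V₁ V₂).injective (by
    rw [LinearMap.zero_apply, map_zero]; exact LinearMap.congr_fun h x)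

theorem restrictedHom_ne_bot_of_swap (h : D.swap.restrictedHom ρ τ₂ τ₁ ≠ ⊥) :
    D.restrictedHom ρ τ₁ τ₂ ≠ ⊥ := by
  obtain ⟨l, hl, hl0⟩ := Submodule.ne_bot_iff _ |>.1 h
  exact (Submodule.ne_bot_iff _).2
    ⟨_, comm_comp_mem_restrictedHom hl, fun h0 => hl0 (comm_comp_eq_zero h0)⟩

theorem restrictedHom_ne_bot_congr {W₁' W₂' : Type*} [AddCommGroup W₁'] [Module ℂ W₁']
    [AddCommGroup W₂'] [Module ℂ W₂'] {τ₁' : Representation ℂ H₁ W₁'}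
    {τ₂' : Representation ℂ H₂ W₂'} (e₁ : τ₁.Equiv τ₁') (e₂ : τ₂.Equiv τ₂')
    (h : D.restrictedHom ρ τ₁ τ₂ ≠ ⊥) : D.restrictedHom ρ τ₁' τ₂' ≠ ⊥ := by
  obtain ⟨l, hl, hl0⟩ := Submodule.ne_bot_iff _ |>.1 h
  let e := TensorProduct.congr e₁.toLinearEquiv e₂.toLinearEquiv
  refine (Submodule.ne_bot_iff _).2 ⟨e.toLinearMap ∘ₗ l, fun h x => ?_, fun h0 => hl0 ?_⟩
  · rw [LinearMap.comp_apply, hl h x]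
    change TensorProduct.map e₁.toLinearMap e₂.toLinearMap _ =
      TensorProduct.map _ _ (TensorProduct.map e₁.toLinearMap e₂.toLinearMap _)
    rw [← LinearMap.comp_apply, ← TensorProduct.map_comp, e₁.isIntertwining', e₂.isIntertwining',
      TensorProduct.map_comp]
    rfl
  · exact LinearMap.ext fun x => e.injective (by
      rw [LinearMap.zero_apply, map_zero]; exact LinearMap.congr_fun h0 x)

theorem map_comp_mem_restrictedHom {f : V →ₗ[ℂ] V₁ ⊗[ℂ] V₂} (hf : f ∈ D.graphHom ρ π₁ π₂)
    {p₁ : V₁ →ₗ[ℂ] W₁} {p₂ : V₂ →ₗ[ℂ] W₂} (hp₁ : p₁ ∈ homSpace π₁ τ₁) (hp₂ : p₂ ∈ homSpace π₂ τ₂) :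
    TensorProduct.map p₁ p₂ ∘ₗ f ∈ D.restrictedHom ρ τ₁ τ₂ := fun h x => by
  have e₁ : p₁ ∘ₗ π₁ h.1 = τ₁ h.1 ∘ₗ p₁ := LinearMap.ext (hp₁ h.1)
  have e₂ : p₂ ∘ₗ π₂ h.2 = τ₂ h.2 ∘ₗ p₂ := LinearMap.ext (hp₂ h.2)
  rw [LinearMap.comp_apply, hf, D.fst_incl, D.snd_incl, LinearMap.comp_apply, ← LinearMap.comp_apply,
    ← TensorProduct.map_comp, e₁, e₂, TensorProduct.map_comp]
  rfl

theorem map_comp_mem_graphHom {V₁' V₂' : Type*} [AddCommGroup V₁'] [Module ℂ V₁']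
    [AddCommGroup V₂'] [Module ℂ V₂'] {π₁' : Representation ℂ G₁ V₁'} {π₂' : Representation ℂ G₂ V₂'}
    {f : V →ₗ[ℂ] V₁ ⊗[ℂ] V₂} (hf : f ∈ D.graphHom ρ π₁ π₂) {j₁ : V₁ →ₗ[ℂ] V₁'} {j₂ : V₂ →ₗ[ℂ] V₂'}
    (hj₁ : ∀ g x, j₁ (π₁ g x) = π₁' g (j₁ x)) (hj₂ : ∀ g x, j₂ (π₂ g x) = π₂' g (j₂ x)) :
    TensorProduct.map j₁ j₂ ∘ₗ f ∈ D.graphHom ρ π₁' π₂' := fun a x => by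
  have e₁ : j₁ ∘ₗ π₁ (D.fst a) = π₁' (D.fst a) ∘ₗ j₁ := LinearMap.ext (hj₁ _)
  have e₂ : j₂ ∘ₗ π₂ (D.snd a) = π₂' (D.snd a) ∘ₗ j₂ := LinearMap.ext (hj₂ _)
  rw [LinearMap.comp_apply, hf, LinearMap.comp_apply, ← LinearMap.comp_apply,
    ← TensorProduct.map_comp, e₁, e₂, TensorProduct.map_comp]
  rfl

theorem map_comp_comp_rep {f : V →ₗ[ℂ] V₁ ⊗[ℂ] V₂} (hf : f ∈ D.graphHom ρ π₁ π₂)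
    (p₁ : V₁ →ₗ[ℂ] W₁) (p₂ : V₂ →ₗ[ℂ] W₂) (a : Γ) :
    TensorProduct.map (p₁ ∘ₗ π₁ (D.fst a)) (p₂ ∘ₗ π₂ (D.snd a)) ∘ₗ f =
      (TensorProduct.map p₁ p₂ ∘ₗ f) ∘ₗ ρ a := LinearMap.ext fun x => by
  rw [LinearMap.comp_apply, LinearMap.comp_apply, LinearMap.comp_apply, hf, TensorProduct.map_comp,
    LinearMap.comp_apply]

theorem comp_rep_eq_zero {U : Type*} [AddCommGroup U] [Module ℂ U] {l : V →ₗ[ℂ] U} {a : Γ}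
    (h : l ∘ₗ ρ a = 0) : l = 0 := LinearMap.ext fun x => by
  have := LinearMap.congr_fun h (ρ a⁻¹ x)
  rwa [LinearMap.comp_apply, ← Module.End.mul_apply, ← map_mul, mul_inv_cancel, map_one] at this

section Normal

variable [H₁.Normal] [H₂.Normal]

theorem comp_rep_mem_restrictedHom {l : V →ₗ[ℂ] W₁ ⊗[ℂ] W₂} (hl : l ∈ D.restrictedHom ρ τ₁ τ₂)
    (a : Γ) : l ∘ₗ ρ a ∈ D.restrictedHom ρ (conjRep τ₁ (D.fst a)) (conjRep τ₂ (D.snd a)) :=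
  fun h x => by
    have e : a * D.incl h = D.incl (MulAut.conjNormal (D.fst a) h.1,
        MulAut.conjNormal (D.snd a) h.2) * a :=
      D.ext (by simp [D.fst_incl]) (by simp [D.snd_incl])
    rw [LinearMap.comp_apply, ← Module.End.mul_apply, ← map_mul, e, map_mul, Module.End.mul_apply, hl]
    rfl

theorem restrictedHom_conjRep_ne_bot (h : D.restrictedHom ρ τ₁ τ₂ ≠ ⊥) (a : Γ) :
    D.restrictedHom ρ (conjRep τ₁ (D.fst a)) (conjRep τ₂ (D.snd a)) ≠ ⊥ := by
  obtain ⟨l, hl, hl0⟩ := Submodule.ne_bot_iff _ |>.1 h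
  exact (Submodule.ne_bot_iff _).2
    ⟨_, comp_rep_mem_restrictedHom hl a, fun h0 => hl0 (comp_rep_eq_zero h0)⟩

end Normal

variable (f : V →ₗ[ℂ] V₁ ⊗[ℂ] V₂) (π₁ π₂ τ₁ τ₂)

/-- The right kernel of the pairing `(p₁, p₂) ↦ (p₁ ⊗ p₂) ∘ f` of `Hom_{H₁}(π₁, τ₁)` with
`Hom_{H₂}(π₂, τ₂)`. -/
def rightKernel : Submodule ℂ (V₂ →ₗ[ℂ] W₂) where
  carrier := {p₂ | p₂ ∈ homSpace π₂ τ₂ ∧ ∀ p₁ ∈ homSpace π₁ τ₁, TensorProduct.map p₁ p₂ ∘ₗ f = 0}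
  zero_mem' := ⟨Submodule.zero_mem _, by simp⟩
  add_mem' := fun ha hb => ⟨Submodule.add_mem _ ha.1 hb.1, fun p hp => by
    rw [TensorProduct.map_add_right, LinearMap.add_comp, ha.2 p hp, hb.2 p hp, add_zero]⟩
  smul_mem' := fun c a ha => ⟨Submodule.smul_mem _ c ha.1, fun p hp => by
    rw [TensorProduct.map_smul_right, LinearMap.smul_comp, ha.2 p hp, smul_zero]⟩

theorem rightKernel_le_homSpace : rightKernel π₁ π₂ τ₁ τ₂ f ≤ homSpace π₂ τ₂ := fun _ h => h.1

end Algebra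

theorem IsThetaOn.swap [TopologicalSpace G₁] [TopologicalSpace G₂] (h : D.IsThetaOn.{v} ρ) :
    D.swap.IsThetaOn.{v} ρ where
  snd_equiv W₁ W₂ W₂' _ _ _ _ _ _ τ₁ τ₂ τ₂' h₁ h₂ h₂' h3 h4 :=
    h.fst_equiv _ _ _ τ₂ τ₂' τ₁ h₂ h₂' h₁ (restrictedHom_ne_bot_of_swap h3)
      (restrictedHom_ne_bot_of_swap h4)
  fst_equiv W₁ W₁' W₂ _ _ _ _ _ _ τ₁ τ₁' τ₂ h₁ h₁' h₂ h3 h4 :=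
    h.snd_equiv _ _ _ τ₂ τ₁ τ₁' h₂ h₁ h₁' (restrictedHom_ne_bot_of_swap h3)
      (restrictedHom_ne_bot_of_swap h4)
  exists_smul_eq W₁ W₂ _ _ _ _ τ₁ τ₂ h₁ h₂ l hl l' hl' h0 := by
    obtain ⟨c, hc⟩ := h.exists_smul_eq _ _ τ₂ τ₁ h₂ h₁ _ (comm_comp_mem_restrictedHom hl) _
      (comm_comp_mem_restrictedHom hl') fun h0' => h0 (comm_comp_eq_zero h0')
    refine ⟨c, sub_eq_zero.1 (comm_comp_eq_zero ?_)⟩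
    rw [LinearMap.comp_sub, LinearMap.comp_smul, hc, sub_self]

section Topology

variable [TopologicalSpace G₁] [IsTopologicalGroup G₁] [TopologicalSpace G₂]
  [H₁.Normal] [H₂.Normal]
variable {V₁ V₂ W₁ W₂ : Type v} [AddCommGroup V₁] [Module ℂ V₁] [AddCommGroup V₂] [Module ℂ V₂]
  [AddCommGroup W₁] [Module ℂ W₁] [AddCommGroup W₂] [Module ℂ W₂]
  {π₁ : Representation ℂ G₁ V₁} {π₂ : Representation ℂ G₂ V₂}
  {τ₁ : Representation ℂ H₁ W₁} {τ₂ : Representation ℂ H₂ W₂}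

/-- The right kernel is twist stable: as `ρ` is a theta representation on `H₁ × H₂`, the element
`g` of `G₂` stabilizes `τ₂` only if every `(g', g) ∈ Γ` has `g'` in the stabilizer of `τ₁`. -/
theorem twistStable_rightKernel (hθ : D.IsThetaOn.{v} ρ) (hτ₁ : IsSmoothIrreducible τ₁)
    (hτ₂ : IsSmoothIrreducible τ₂) (h0 : D.restrictedHom ρ τ₁ τ₂ ≠ ⊥) {f : V →ₗ[ℂ] V₁ ⊗[ℂ] V₂}
    (hf : f ∈ D.graphHom ρ π₁ π₂) : TwistStable π₂ τ₂ (rightKernel π₁ π₂ τ₁ τ₂ f) := by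
  intro p₂ hp₂ g A hA
  refine ⟨comp_mem_homSpace (comp_rep_mem_homSpace hp₂.1 g) hA, fun p₁ hp₁ => ?_⟩
  by_cases hA0 : A = 0
  · rw [hA0, LinearMap.zero_comp, TensorProduct.map_zero_right, LinearMap.zero_comp]
  obtain ⟨e₂⟩ := exists_equiv_of_isIrreducible (isIrreducible_conjRep hτ₂.2 g) hτ₂.2 hA hA0
  obtain ⟨a, rfl⟩ := D.snd_surjective g
  have h1 := restrictedHom_conjRep_ne_bot h0 a
  have h2 := restrictedHom_ne_bot_congr (.refl _) e₂ h1
  obtain ⟨e₁⟩ := hθ.fst_equiv _ _ _ _ _ _ (hτ₁.conjRep (D.fst a)) hτ₁ hτ₂ h2 h0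
  -- Write `p₁` as a twist by the same element of `Γ`.
  let p₁' : V₁ →ₗ[ℂ] W₁ := (e₁.symm.toLinearMap ∘ₗ p₁) ∘ₗ π₁ (D.fst a)⁻¹
  have hp₁' : p₁' ∈ homSpace π₁ τ₁ := by
    have := comp_rep_mem_homSpace (comp_mem_homSpace hp₁ (A := e₁.symm.toLinearMap)
      (equiv_apply_rep e₁.symm)) (D.fst a)⁻¹
    rwa [conjRep_conjRep, mul_inv_cancel, conjRep_one] at this
  have e : p₁ = e₁.toLinearMap ∘ₗ p₁' ∘ₗ π₁ (D.fst a) := LinearMap.ext fun x => by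
    change p₁ x = e₁ (e₁.symm (p₁ (π₁ (D.fst a)⁻¹ (π₁ (D.fst a) x))))
    rw [Representation.Equiv.apply_symm_apply, ← Module.End.mul_apply, ← map_mul, inv_mul_cancel,
      map_one, Module.End.one_apply]
  rw [e, TensorProduct.map_comp, LinearMap.comp_assoc, map_comp_comp_rep hf, hp₂.2 _ hp₁',
    LinearMap.zero_comp, LinearMap.comp_zero]

end Topology

end GraphDatum

end Graph

/-! ### The pairing of Hom spaces -/

section Core

/-- The hypotheses on an open subgroup `H` of `G`: irreducible smooth representations of `G` and of
`H` are admissible, and those of `G` have an irreducible quotient over `H`. -/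
structure IsAdmissiblePair {G : Type*} [Group G] [TopologicalSpace G] (H : Subgroup G) : Prop where
  isOpen : IsOpen (H : Set G)
  admissible : IrreduciblesAdmissible.{_, v} G
  admissible_subgroup : IrreduciblesAdmissible.{_, v} H
  quotient : ∀ (V : Type v) [AddCommGroup V] [Module ℂ V] (π : Representation ℂ G V),
    IsSmoothIrreducible π → HasIrreducibleQuotient.{_, v, v} (π.comp H.subtype)

theorem IsAdmissiblePair.exists_homSpace {G : Type*} [Group G] [TopologicalSpace G] {H : Subgroup G}
    (h : IsAdmissiblePair.{v} H) {V : Type v} [AddCommGroup V] [Module ℂ V]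
    {π : Representation ℂ G V} (hπ : IsSmoothIrreducible π) :
    ∃ (W : Type v) (_ : AddCommGroup W) (_ : Module ℂ W) (τ : Representation ℂ H W),
      IsSmoothIrreducible τ ∧ ∃ p ∈ homSpace π τ, p ≠ 0 := by
  obtain ⟨W, _, _, τ, hτ, f, hf⟩ := h.quotient V π hπ
  exact ⟨W, _, _, τ, hτ, f.toLinearMap, fun h x => LinearMap.congr_fun (f.isIntertwining' h) x,
    fun h0 => hf (Representation.IntertwiningMap.ext h0)⟩

/-- For a perfect pairing `B`, any other pairing is obtained from `B` by a linear map. -/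
theorem exists_comp_eq_of_isPerfPair {P Q Q' : Type*} [AddCommGroup P] [Module ℂ P]
    [AddCommGroup Q] [Module ℂ Q] [AddCommGroup Q'] [Module ℂ Q'] (B : P →ₗ[ℂ] Q →ₗ[ℂ] ℂ)
    [B.IsPerfPair] (B' : P →ₗ[ℂ] Q' →ₗ[ℂ] ℂ) : ∃ T : Q' →ₗ[ℂ] Q, ∀ p q, B p (T q) = B' p q := by
  refine ⟨B.flip.toPerfPair.symm.toLinearMap ∘ₗ B'.flip, fun p q => ?_⟩
  change B.flip (B.flip.toPerfPair.symm (B'.flip q)) p = B'.flip q p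
  rw [← LinearMap.toLinearMap_toPerfPair, LinearEquiv.apply_symm_apply]

/-- Goursat's lemma for irreducible representations: a nonzero subrepresentation of `π ⊕ π'` that
meets both summands trivially is the graph of an equivalence. -/
theorem exists_equiv_of_subspace_prod {G V V' : Type*} [Group G] [AddCommGroup V] [Module ℂ V]
    [AddCommGroup V'] [Module ℂ V'] {π : Representation ℂ G V} {π' : Representation ℂ G V'}
    (hπ : π.IsIrreducible) (hπ' : π'.IsIrreducible) {X : Submodule ℂ (V × V')}
    (hX : ∀ g, ∀ x ∈ X, (π.prod π') g x ∈ X) (h0 : X ≠ ⊥) (hl : ∀ x, (x, (0 : V')) ∈ X → x = 0)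
    (hr : ∀ x, ((0 : V), x) ∈ X → x = 0) : Nonempty (π.Equiv π') := by
  let ξ : Representation ℂ G X := Representation.subrepresentation (π.prod π') X hX
  obtain ⟨x, hx, hx0⟩ := X.ne_bot_iff.1 h0
  have hinj : Function.Injective (LinearMap.fst ℂ V V' ∘ₗ X.subtype) :=
    (injective_iff_map_eq_zero _).2 fun y (h : y.1.1 = 0) => by
      have hy : (y.1.1, y.1.2) ∈ X := y.2
      rw [h] at hy
      exact Subtype.ext (Prod.ext h (hr _ hy))
  have hinj' : Function.Injective (LinearMap.snd ℂ V V' ∘ₗ X.subtype) :=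
    (injective_iff_map_eq_zero _).2 fun y (h : y.1.2 = 0) => by
      have hy : (y.1.1, y.1.2) ∈ X := y.2
      rw [h] at hy
      exact Subtype.ext (Prod.ext (hl _ hy) h)
  obtain ⟨e⟩ := exists_equiv_of_bijective (π := ξ) (σ := π) (fun g x => rfl)
    ⟨hinj, surjective_of_isIrreducible (π := ξ) hπ (fun g x => rfl) fun h =>
      hx0 (congrArg Subtype.val (hinj (a₁ := ⟨x, hx⟩) (a₂ := 0) (by rw [h]; rfl)))⟩
  obtain ⟨e'⟩ := exists_equiv_of_bijective (π := ξ) (σ := π') (fun g x => rfl)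
    ⟨hinj', surjective_of_isIrreducible (π := ξ) hπ' (fun g x => rfl) fun h =>
      hx0 (congrArg Subtype.val (hinj' (a₁ := ⟨x, hx⟩) (a₂ := 0) (by rw [h]; rfl)))⟩
  exact ⟨e.symm.trans e'⟩

variable {Γ : Type*} [Group Γ] {G₁ G₂ : Type*} [Group G₁] [Group G₂] {H₁ : Subgroup G₁}
  {H₂ : Subgroup G₂} {D : GraphDatum Γ H₁ H₂}
  {V : Type*} [AddCommGroup V] [Module ℂ V] {ρ : Representation ℂ Γ V}

namespace GraphDatum

section Algebra

variable {V₁ V₂ W₁ W₂ : Type*} [AddCommGroup V₁] [Module ℂ V₁] [AddCommGroup V₂] [Module ℂ V₂]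
  [AddCommGroup W₁] [Module ℂ W₁] [AddCommGroup W₂] [Module ℂ W₂]
  {π₁ : Representation ℂ G₁ V₁} {π₂ : Representation ℂ G₂ V₂}
  {τ₁ : Representation ℂ H₁ W₁} {τ₂ : Representation ℂ H₂ W₂}

/-- The pairing `(p₁, p₂) ↦ E ((p₁ ⊗ p₂) ∘ f)` of `Hom_{H₁}(π₁, τ₁)` with `Hom_{H₂}(π₂, τ₂)`. The
linear form `E` serves to identify the line `Hom_{H₁ × H₂}(ρ, τ₁ ⊗ τ₂)` with `ℂ`. -/
noncomputable def pairing (π₁ : Representation ℂ G₁ V₁) (π₂ : Representation ℂ G₂ V₂)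
    (τ₁ : Representation ℂ H₁ W₁) (τ₂ : Representation ℂ H₂ W₂)
    (E : (V →ₗ[ℂ] W₁ ⊗[ℂ] W₂) →ₗ[ℂ] ℂ) (f : V →ₗ[ℂ] V₁ ⊗[ℂ] V₂) :
    homSpace π₁ τ₁ →ₗ[ℂ] homSpace π₂ τ₂ →ₗ[ℂ] ℂ :=
  LinearMap.mk₂ ℂ (fun p₁ p₂ => E (TensorProduct.map p₁.1 p₂.1 ∘ₗ f))
    (fun p q r => by
      rw [← map_add, ← LinearMap.add_comp, ← TensorProduct.map_add_left]; rfl)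
    (fun c p r => by
      rw [← map_smul, ← LinearMap.smul_comp, ← TensorProduct.map_smul_left]; rfl)
    (fun p q r => by
      rw [← map_add, ← LinearMap.add_comp, ← TensorProduct.map_add_right]; rfl)
    (fun c p r => by
      rw [← map_smul, ← LinearMap.smul_comp, ← TensorProduct.map_smul_right]; rfl)

theorem pairing_apply (E : (V →ₗ[ℂ] W₁ ⊗[ℂ] W₂) →ₗ[ℂ] ℂ) (f : V →ₗ[ℂ] V₁ ⊗[ℂ] V₂)
    (p₁ : homSpace π₁ τ₁) (p₂ : homSpace π₂ τ₂) :
    pairing π₁ π₂ τ₁ τ₂ E f p₁ p₂ = E (TensorProduct.map p₁.1 p₂.1 ∘ₗ f) := rfl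

theorem exists_linearForm (h : ∀ l ∈ D.restrictedHom ρ τ₁ τ₂, ∀ l' ∈ D.restrictedHom ρ τ₁ τ₂,
    l ≠ 0 → ∃ c : ℂ, c • l = l') :
    ∃ E : (V →ₗ[ℂ] W₁ ⊗[ℂ] W₂) →ₗ[ℂ] ℂ, ∀ l ∈ D.restrictedHom ρ τ₁ τ₂, E l = 0 → l = 0 := by
  by_cases h0 : D.restrictedHom ρ τ₁ τ₂ = ⊥
  · exact ⟨0, fun l hl _ => by rwa [h0] at hl⟩
  obtain ⟨l, hl, hl0⟩ := Submodule.ne_bot_iff _ |>.1 h0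
  obtain ⟨E, hE⟩ := Module.Projective.exists_dual_eq_one ℂ hl0
  refine ⟨E, fun l' hl' h' => ?_⟩
  obtain ⟨c, rfl⟩ := h l hl l' hl' hl0
  rw [map_smul, hE, smul_eq_mul, mul_one] at h'
  rw [h', zero_smul]

/-- A nonzero `f ∈ Hom_Γ(ρ, π₁ ⊗ π₂)` has a nonzero component for a given quotient `τ₁` of `π₁` and
some twist of a given quotient `τ₂` of `π₂`. -/
theorem exists_map_comp_ne_zero [H₂.Normal] (hπ₁ : π₁.IsIrreducible) (hπ₂ : π₂.IsIrreducible)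
    {p₁ : V₁ →ₗ[ℂ] W₁} (hp₁ : p₁ ≠ 0) {p₂ : V₂ →ₗ[ℂ] W₂} (hp₂ : p₂ ∈ homSpace π₂ τ₂)
    (hp₂0 : p₂ ≠ 0) {f : V →ₗ[ℂ] V₁ ⊗[ℂ] V₂} (hf : f ∈ D.graphHom ρ π₁ π₂) (hf0 : f ≠ 0) :
    ∃ g, ∃ q ∈ homSpace π₂ (conjRep τ₂ g), TensorProduct.map p₁ q ∘ₗ f ≠ 0 := by
  by_contra! hcon
  refine hf0 (LinearMap.ext fun x => eq_zero_of_forall_map_eq_zero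
    (P := Set.range fun g => p₁ ∘ₗ π₁ g) (P' := Set.range fun g => p₂ ∘ₗ π₂ g)
    (fun y hy => eq_zero_of_forall_apply_eq_zero hπ₁ hp₁ fun g => hy _ ⟨g, rfl⟩)
    (fun y hy => eq_zero_of_forall_apply_eq_zero hπ₂ hp₂0 fun g => hy _ ⟨g, rfl⟩) ?_)
  rintro _ ⟨g₁, rfl⟩ _ ⟨g₂, rfl⟩
  obtain ⟨a, rfl⟩ := D.fst_surjective g₁
  have e : p₂ ∘ₗ π₂ g₂ = (p₂ ∘ₗ π₂ (g₂ * (D.snd a)⁻¹)) ∘ₗ π₂ (D.snd a) := by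
    rw [LinearMap.comp_assoc, ← Module.End.mul_eq_comp, ← map_mul, inv_mul_cancel_right]
  have := map_comp_comp_rep hf p₁ (p₂ ∘ₗ π₂ (g₂ * (D.snd a)⁻¹)) a
  rw [← e, hcon _ _ (comp_rep_mem_homSpace hp₂ _), LinearMap.zero_comp] at this
  exact LinearMap.congr_fun this x

end Algebra

section Topology

variable [TopologicalSpace G₁] [TopologicalSpace G₂] [IsTopologicalGroup G₂] [H₂.Normal]
variable {V₁ V₂ W₁ W₂ : Type v} [AddCommGroup V₁] [Module ℂ V₁] [AddCommGroup V₂] [Module ℂ V₂]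
  [AddCommGroup W₁] [Module ℂ W₁] [AddCommGroup W₂] [Module ℂ W₂]
  {π₁ : Representation ℂ G₁ V₁} {π₂ : Representation ℂ G₂ V₂}
  {τ₁ : Representation ℂ H₁ W₁} {τ₂ : Representation ℂ H₂ W₂}
  {f : V →ₗ[ℂ] V₁ ⊗[ℂ] V₂}

/-- For a nonzero `f ∈ Hom_Γ(ρ, π₁ ⊗ π₂)` and a quotient `τ₁` of `π₁`, there is a `τ₂` for which the
pairing is nonzero. -/
theorem exists_restrictedHom (h₂ : IsAdmissiblePair.{v} H₂) (hπ₁ : IsSmoothIrreducible π₁)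
    (hπ₂ : IsSmoothIrreducible π₂) {p₁ : V₁ →ₗ[ℂ] W₁} (hp₁0 : p₁ ≠ 0)
    (hf : f ∈ D.graphHom ρ π₁ π₂) (hf0 : f ≠ 0) :
    ∃ (W₂ : Type v) (_ : AddCommGroup W₂) (_ : Module ℂ W₂) (τ₂ : Representation ℂ H₂ W₂),
      IsSmoothIrreducible τ₂ ∧ ∃ p₂ ∈ homSpace π₂ τ₂, TensorProduct.map p₁ p₂ ∘ₗ f ≠ 0 := by
  obtain ⟨W, _, _, τ, hτ, p, hp, hp0⟩ := h₂.exists_homSpace hπ₂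
  obtain ⟨g, q, hq, hq0⟩ := exists_map_comp_ne_zero hπ₁.2 hπ₂.2 hp₁0 hp hp0 hf hf0
  exact ⟨W, _, _, _, hτ.conjRep g, q, hq, hq0⟩

/-- The same, for a given `τ₂` such that `τ₁ ⊗ τ₂` is a quotient of `ρ`. -/
theorem exists_map_comp_ne_zero_of_restrictedHom (hθ : D.IsThetaOn.{v} ρ)
    (h₂ : IsAdmissiblePair.{v} H₂) (hπ₁ : IsSmoothIrreducible π₁) (hπ₂ : IsSmoothIrreducible π₂)
    (hτ₁ : IsSmoothIrreducible τ₁) (hτ₂ : IsSmoothIrreducible τ₂)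
    (hbot : D.restrictedHom ρ τ₁ τ₂ ≠ ⊥) {p₁ : V₁ →ₗ[ℂ] W₁} (hp₁ : p₁ ∈ homSpace π₁ τ₁)
    (hp₁0 : p₁ ≠ 0) (hf : f ∈ D.graphHom ρ π₁ π₂) (hf0 : f ≠ 0) :
    ∃ p₂ ∈ homSpace π₂ τ₂, TensorProduct.map p₁ p₂ ∘ₗ f ≠ 0 := by
  obtain ⟨W, _, _, τ, hτ, p, hp, hp0⟩ := exists_restrictedHom h₂ hπ₁ hπ₂ hp₁0 hf hf0
  obtain ⟨e⟩ := hθ.snd_equiv _ _ _ τ₁ τ τ₂ hτ₁ hτ hτ₂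
    ((Submodule.ne_bot_iff _).2 ⟨_, map_comp_mem_restrictedHom hf hp₁ hp, hp0⟩) hbot
  refine ⟨e.toLinearMap ∘ₗ p, comp_mem_homSpace hp (equiv_apply_rep e), fun h => hp0 ?_⟩
  have h' : (e.toLinearEquiv.lTensor W₁).toLinearMap ∘ₗ TensorProduct.map p₁ p ∘ₗ f = 0 := by
    rw [← h, ← LinearMap.comp_assoc]
    congr 1
    exact TensorProduct.ext' fun x y => rfl
  exact LinearMap.ext fun x => (e.toLinearEquiv.lTensor W₁).injective (by
      rw [LinearMap.zero_apply, map_zero]; exact LinearMap.congr_fun h' x)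

variable [IsTopologicalGroup G₁] [H₁.Normal]

theorem rightKernel_eq_bot [T2Space G₂] [LocallyCompactSpace G₂] [TotallyDisconnectedSpace G₂]
    (hθ : D.IsThetaOn.{v} ρ) (h₂ : IsAdmissiblePair.{v} H₂)
    (hπ₂ : IsSmoothIrreducible π₂) (hτ₁ : IsSmoothIrreducible τ₁) (hτ₂ : IsSmoothIrreducible τ₂)
    (hf : f ∈ D.graphHom ρ π₁ π₂) {p₁ : V₁ →ₗ[ℂ] W₁} (hp₁ : p₁ ∈ homSpace π₁ τ₁)
    {p₂ : V₂ →ₗ[ℂ] W₂} (hp₂ : p₂ ∈ homSpace π₂ τ₂) (h0 : TensorProduct.map p₁ p₂ ∘ₗ f ≠ 0) :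
    rightKernel π₁ π₂ τ₁ τ₂ f = ⊥ := by
  by_contra hne
  have hbot : D.restrictedHom ρ τ₁ τ₂ ≠ ⊥ :=
    (Submodule.ne_bot_iff _).2 ⟨_, map_comp_mem_restrictedHom hf hp₁ hp₂, h0⟩
  exact h0 ((homSpace_le_of_twistStable_of_isIrreducible hπ₂ (h₂.admissible _ _ hπ₂) h₂.isOpen hτ₂
    (rightKernel_le_homSpace _ _ _ _ _) (twistStable_rightKernel hθ hτ₁ hτ₂ hbot hf) hne hp₂).2 p₁ hp₁)

theorem eq_zero_of_forall_map_comp_eq_zero [T2Space G₁] [LocallyCompactSpace G₁]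
    [TotallyDisconnectedSpace G₁] (hθ : D.IsThetaOn.{v} ρ) (h₁ : IsAdmissiblePair.{v} H₁)
    (hπ₁ : IsSmoothIrreducible π₁) (hτ₁ : IsSmoothIrreducible τ₁) (hτ₂ : IsSmoothIrreducible τ₂)
    (hf : f ∈ D.graphHom ρ π₁ π₂) {p₁ : V₁ →ₗ[ℂ] W₁} (hp₁ : p₁ ∈ homSpace π₁ τ₁)
    {p₂ : V₂ →ₗ[ℂ] W₂} (hp₂ : p₂ ∈ homSpace π₂ τ₂) (h0 : TensorProduct.map p₁ p₂ ∘ₗ f ≠ 0)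
    {q : V₁ →ₗ[ℂ] W₁} (hq : q ∈ homSpace π₁ τ₁)
    (hq0 : ∀ p ∈ homSpace π₂ τ₂, TensorProduct.map q p ∘ₗ f = 0) : q = 0 := by
  have e : ∀ (p₁ : V₁ →ₗ[ℂ] W₁) (p₂ : V₂ →ₗ[ℂ] W₂),
      TensorProduct.map p₂ p₁ ∘ₗ (TensorProduct.comm ℂ V₁ V₂).toLinearMap ∘ₗ f =
        (TensorProduct.comm ℂ W₁ W₂).toLinearMap ∘ₗ TensorProduct.map p₁ p₂ ∘ₗ f :=
    fun p₁ p₂ => LinearMap.ext fun x => comm_map p₁ p₂ (f x)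
  have := rightKernel_eq_bot hθ.swap h₁ hπ₁ hτ₂ hτ₁ (comm_comp_mem_graphHom hf) hp₂ hp₁
    fun h => h0 (comm_comp_eq_zero (by rw [← e, h]))
  rw [← Submodule.mem_bot ℂ, ← this]
  exact ⟨hq, fun p hp => by rw [e, hq0 p hp, LinearMap.comp_zero]⟩

variable [T2Space G₁] [LocallyCompactSpace G₁] [TotallyDisconnectedSpace G₁] [T2Space G₂]
  [LocallyCompactSpace G₂] [TotallyDisconnectedSpace G₂]

/-- If the pairing defined by `f` is nonzero, then it is perfect: its kernels are twist stable and
the Hom spaces have no proper nonzero twist stable subspaces. -/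
theorem isPerfPair_pairing (hθ : D.IsThetaOn.{v} ρ) (h₁ : IsAdmissiblePair.{v} H₁)
    (h₂ : IsAdmissiblePair.{v} H₂) (hπ₁ : IsSmoothIrreducible π₁) (hπ₂ : IsSmoothIrreducible π₂)
    (hτ₁ : IsSmoothIrreducible τ₁) (hτ₂ : IsSmoothIrreducible τ₂)
    {E : (V →ₗ[ℂ] W₁ ⊗[ℂ] W₂) →ₗ[ℂ] ℂ} (hE : ∀ l ∈ D.restrictedHom ρ τ₁ τ₂, E l = 0 → l = 0)
    (hf : f ∈ D.graphHom ρ π₁ π₂) {p₁ : V₁ →ₗ[ℂ] W₁} (hp₁ : p₁ ∈ homSpace π₁ τ₁)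
    {p₂ : V₂ →ₗ[ℂ] W₂} (hp₂ : p₂ ∈ homSpace π₂ τ₂) (h0 : TensorProduct.map p₁ p₂ ∘ₗ f ≠ 0) :
    (pairing π₁ π₂ τ₁ τ₂ E f).IsPerfPair := by
  have := finiteDimensional_homSpace hπ₁.1 (h₁.admissible _ _ hπ₁) h₁.isOpen hτ₁
    (h₁.admissible_subgroup _ _ hτ₁)
  refine LinearMap.IsPerfPair.of_injective ((injective_iff_map_eq_zero _).2 fun q hq => ?_)
    ((injective_iff_map_eq_zero _).2 fun q hq => ?_)
  · refine Subtype.ext (eq_zero_of_forall_map_comp_eq_zero hθ h₁ hπ₁ hτ₁ hτ₂ hf hp₁ hp₂ h0 q.2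
      fun p hp => hE _ (map_comp_mem_restrictedHom hf q.2 hp) ?_)
    exact LinearMap.congr_fun hq ⟨p, hp⟩
  · refine Subtype.ext ((Submodule.mem_bot ℂ).1 ?_)
    rw [← rightKernel_eq_bot hθ h₂ hπ₂ hτ₁ hτ₂ hf hp₁ hp₂ h0]
    refine ⟨q.2, fun p hp => hE _ (map_comp_mem_restrictedHom hf hp q.2) ?_⟩
    exact LinearMap.congr_fun hq ⟨p, hp⟩

/-- `Hom_Γ(ρ, π₁ ⊗ π₂)` has dimension at most one: given `f` and `f'`, some nontrivial combination
of the two has a degenerate pairing, and is therefore zero. -/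
theorem exists_smul_eq_of_graphHom (hθ : D.IsThetaOn.{v} ρ) (h₁ : IsAdmissiblePair.{v} H₁)
    (h₂ : IsAdmissiblePair.{v} H₂) (hπ₁ : IsSmoothIrreducible π₁) (hπ₂ : IsSmoothIrreducible π₂)
    (hf : f ∈ D.graphHom ρ π₁ π₂) (hf0 : f ≠ 0) {f' : V →ₗ[ℂ] V₁ ⊗[ℂ] V₂}
    (hf' : f' ∈ D.graphHom ρ π₁ π₂) : ∃ c : ℂ, c • f = f' := by
  obtain ⟨W₁, _, _, τ₁, hτ₁, p₁, hp₁, hp₁0⟩ := h₁.exists_homSpace hπ₁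
  obtain ⟨W₂, _, _, τ₂, hτ₂, p₂, hp₂, h0⟩ := exists_restrictedHom h₂ hπ₁ hπ₂ hp₁0 hf hf0
  have hbot : D.restrictedHom ρ τ₁ τ₂ ≠ ⊥ :=
    (Submodule.ne_bot_iff _).2 ⟨_, map_comp_mem_restrictedHom hf hp₁ hp₂, h0⟩
  obtain ⟨E, hE⟩ := exists_linearForm (hθ.exists_smul_eq _ _ τ₁ τ₂ hτ₁ hτ₂)
  have := isPerfPair_pairing hθ h₁ h₂ hπ₁ hπ₂ hτ₁ hτ₂ hE hf hp₁ hp₂ h0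
  obtain ⟨T, hT⟩ := exists_comp_eq_of_isPerfPair (pairing π₁ π₂ τ₁ τ₂ E f)
    (pairing π₁ π₂ τ₁ τ₂ E f')
  have := finiteDimensional_homSpace hπ₂.1 (h₂.admissible _ _ hπ₂) h₂.isOpen hτ₂
    (h₂.admissible_subgroup _ _ hτ₂)
  have : Nontrivial (homSpace π₂ τ₂) := ⟨⟨⟨p₂, hp₂⟩, 0, fun h => h0 (by
    rw [show p₂ = 0 from congrArg Subtype.val h, TensorProduct.map_zero_right,
      LinearMap.zero_comp])⟩⟩
  obtain ⟨c, hc⟩ := Module.End.exists_eigenvalue T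
  obtain ⟨q, hq⟩ := hc.exists_hasEigenvector
  refine ⟨c, ?_⟩
  by_contra hne
  have hk : f' - c • f ∈ D.graphHom ρ π₁ π₂ := Submodule.sub_mem _ hf' (Submodule.smul_mem _ c hf)
  obtain ⟨r, hr, hr0⟩ := exists_map_comp_ne_zero_of_restrictedHom hθ h₂ hπ₁ hπ₂ hτ₁ hτ₂ hbot hp₁
    hp₁0 hk fun h => hne (sub_eq_zero.1 h).symm
  have hmem : q.1 ∈ rightKernel π₁ π₂ τ₁ τ₂ (f' - c • f) := by
    refine ⟨q.2, fun p hp => hE _ (map_comp_mem_restrictedHom hk hp q.2) ?_⟩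
    have := hT ⟨p, hp⟩ q
    rw [hq.apply_eq_smul, map_smul, pairing_apply, pairing_apply] at this
    rw [LinearMap.comp_sub, map_sub, LinearMap.comp_smul, map_smul, this, sub_self]
  rw [rightKernel_eq_bot hθ h₂ hπ₂ hτ₁ hτ₂ hk hp₁ hr hr0, Submodule.mem_bot] at hmem
  exact hq.2 (Subtype.ext hmem)

/-- If `π₁ ⊗ π₂` and `π₁ ⊗ π₂'` both occur, then `π₂` and `π₂'` are equivalent. The right kernel of
the difference of the two pairings is a proper twist stable subspace of `Hom_{H₂}(π₂ ⊕ π₂', τ₂)`, so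
that it cuts out a nonzero subrepresentation of `π₂ ⊕ π₂'`; as the right kernel is the graph of a
bijection, this subrepresentation is the graph of an equivalence. -/
theorem exists_equiv_of_graphHom (hθ : D.IsThetaOn.{v} ρ) (h₁ : IsAdmissiblePair.{v} H₁)
    (h₂ : IsAdmissiblePair.{v} H₂) (hπ₁ : IsSmoothIrreducible π₁) (hπ₂ : IsSmoothIrreducible π₂)
    {V₂' : Type v} [AddCommGroup V₂'] [Module ℂ V₂'] {π₂' : Representation ℂ G₂ V₂'}
    (hπ₂' : IsSmoothIrreducible π₂') (hf : f ∈ D.graphHom ρ π₁ π₂) (hf0 : f ≠ 0)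
    {f' : V →ₗ[ℂ] V₁ ⊗[ℂ] V₂'} (hf' : f' ∈ D.graphHom ρ π₁ π₂') (hf0' : f' ≠ 0) :
    Nonempty (π₂.Equiv π₂') := by
  obtain ⟨W₁, _, _, τ₁, hτ₁, p₁, hp₁, hp₁0⟩ := h₁.exists_homSpace hπ₁
  obtain ⟨W₂, _, _, τ₂, hτ₂, p₂, hp₂, h0⟩ := exists_restrictedHom h₂ hπ₁ hπ₂ hp₁0 hf hf0
  have hbot : D.restrictedHom ρ τ₁ τ₂ ≠ ⊥ :=
    (Submodule.ne_bot_iff _).2 ⟨_, map_comp_mem_restrictedHom hf hp₁ hp₂, h0⟩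
  obtain ⟨p₂', hp₂', h0'⟩ := exists_map_comp_ne_zero_of_restrictedHom hθ h₂ hπ₁ hπ₂' hτ₁ hτ₂ hbot
    hp₁ hp₁0 hf' hf0'
  obtain ⟨E, hE⟩ := exists_linearForm (hθ.exists_smul_eq _ _ τ₁ τ₂ hτ₁ hτ₂)
  have := isPerfPair_pairing hθ h₁ h₂ hπ₁ hπ₂ hτ₁ hτ₂ hE hf hp₁ hp₂ h0
  have := isPerfPair_pairing hθ h₁ h₂ hπ₁ hπ₂' hτ₁ hτ₂ hE hf' hp₁ hp₂' h0'
  obtain ⟨T, hT⟩ := exists_comp_eq_of_isPerfPair (pairing π₁ π₂ τ₁ τ₂ E f)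
    (pairing π₁ π₂' τ₁ τ₂ E f')
  obtain ⟨T', hT'⟩ := exists_comp_eq_of_isPerfPair (pairing π₁ π₂' τ₁ τ₂ E f')
    (pairing π₁ π₂ τ₁ τ₂ E f)
  let F : V →ₗ[ℂ] V₁ ⊗[ℂ] (V₂ × V₂') :=
    TensorProduct.map LinearMap.id (LinearMap.inl ℂ V₂ V₂') ∘ₗ f -
      TensorProduct.map LinearMap.id (LinearMap.inr ℂ V₂ V₂') ∘ₗ f'
  have hF : F ∈ D.graphHom ρ π₁ (π₂.prod π₂') := by
    exact Submodule.sub_mem _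
      (map_comp_mem_graphHom hf (fun g x => rfl) fun g x => by simp)
      (map_comp_mem_graphHom hf' (fun g x => rfl) fun g x => by simp)
  have hmapF : ∀ (p : V₁ →ₗ[ℂ] W₁) (q : V₂ × V₂' →ₗ[ℂ] W₂), TensorProduct.map p q ∘ₗ F =
      TensorProduct.map p (q ∘ₗ LinearMap.inl ℂ V₂ V₂') ∘ₗ f -
        TensorProduct.map p (q ∘ₗ LinearMap.inr ℂ V₂ V₂') ∘ₗ f' := fun p q => by
    rw [LinearMap.comp_sub, ← LinearMap.comp_assoc, ← LinearMap.comp_assoc,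
      ← TensorProduct.map_comp, ← TensorProduct.map_comp, LinearMap.comp_id]
  set R := rightKernel π₁ (π₂.prod π₂') τ₁ τ₂ F with hR
  have hmemR : ∀ (q : homSpace π₂ τ₂) (q' : homSpace π₂' τ₂),
      (∀ p, pairing π₁ π₂ τ₁ τ₂ E f p q = pairing π₁ π₂' τ₁ τ₂ E f' p q') →
        q.1.coprod q'.1 ∈ R := fun q q' h => by
    have hmem : q.1.coprod q'.1 ∈ homSpace (π₂.prod π₂') τ₂ := fun h x => by
      change q.1 (π₂ h x.1) + q'.1 (π₂' h x.2) = τ₂ h (q.1 x.1 + q'.1 x.2)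
      rw [q.2, q'.2, map_add]
    refine ⟨hmem, fun p hp => hE _ (map_comp_mem_restrictedHom hF hp hmem) ?_⟩
    rw [hmapF, LinearMap.coprod_inl, LinearMap.coprod_inr, map_sub, sub_eq_zero]
    exact h ⟨p, hp⟩
  let X : Submodule ℂ (V₂ × V₂') := ⨅ p : R × G₂, LinearMap.ker (p.1.1 ∘ₗ (π₂.prod π₂') p.2)
  have hX : ∀ x, x ∈ X ↔ ∀ p ∈ R, ∀ g, p ((π₂.prod π₂') g x) = 0 := fun x => by
    simp only [X, Submodule.mem_iInf, LinearMap.mem_ker, LinearMap.comp_apply, Prod.forall,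
      Subtype.forall]
  have hXst : ∀ g, ∀ x ∈ X, (π₂.prod π₂') g x ∈ X := fun g x hx => by
    rw [hX] at hx ⊢
    intro p hp g'
    rw [← Module.End.mul_apply, ← map_mul]
    exact hx p hp _
  have hX0 : X ≠ ⊥ := fun h => by
    have hle := homSpace_le_of_twistStable (hπ₂.1.prod hπ₂'.1)
      ((h₂.admissible _ _ hπ₂).prod (h₂.admissible _ _ hπ₂')) h₂.isOpen hτ₂
      (rightKernel_le_homSpace _ _ _ _ _)
      (twistStable_rightKernel hθ hτ₁ hτ₂ hbot hF) fun x hx => by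
        rw [← Submodule.mem_bot ℂ, ← h, hX]
        exact hx
    have hmem : p₂ ∘ₗ LinearMap.fst ℂ V₂ V₂' ∈ homSpace (π₂.prod π₂') τ₂ := fun h x => hp₂ h x.1
    have := (hle hmem).2 p₁ hp₁
    rw [hmapF, LinearMap.comp_assoc, LinearMap.comp_assoc, LinearMap.fst_comp_inl,
      LinearMap.fst_comp_inr, LinearMap.comp_zero, LinearMap.comp_id,
      TensorProduct.map_zero_right, LinearMap.zero_comp, sub_zero] at this
    exact h0 this
  have hinl : ∀ x, (x, (0 : V₂')) ∈ X → x = 0 := fun x hx =>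
    eq_zero_of_forall_apply_eq_zero hπ₂.2 (p := p₂) (fun h => h0 (by
      rw [h, TensorProduct.map_zero_right, LinearMap.zero_comp])) fun g => by
        have := (hX _).1 hx _ (hmemR ⟨p₂, hp₂⟩ (T' ⟨p₂, hp₂⟩) fun p => (hT' _ _).symm) g
        simpa using this
  have hinr : ∀ x, ((0 : V₂), x) ∈ X → x = 0 := fun x hx =>
    eq_zero_of_forall_apply_eq_zero hπ₂'.2 (p := p₂') (fun h => h0' (by
      rw [h, TensorProduct.map_zero_right, LinearMap.zero_comp])) fun g => by
        have := (hX _).1 hx _ (hmemR (T ⟨p₂', hp₂'⟩) ⟨p₂', hp₂'⟩ fun p => hT _ _) g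
        simpa using this
  exact exists_equiv_of_subspace_prod hπ₂.2 hπ₂'.2 hXst hX0 hinl hinr

end Topology

end GraphDatum

end Core

/-! ### Frobenius reciprocity for compact induction from an open subgroup -/

section Frobenius

variable {G : Type*} [Group G] [TopologicalSpace G] {H : Subgroup G}
variable {V : Type*} [AddCommGroup V] [Module ℂ V] {σ : Representation ℂ H V}

open Classical in
/-- The embedding of `σ` in `cInd_H^G σ` for an open subgroup `H`: the vector `x` is sent to the
function supported on `H` with value `σ h x` at `h`. -/
noncomputable def toCInd (hH : IsOpen (H : Set G)) (hσ : IsSmooth σ) : V →ₗ[ℂ] cIndSpace H σ where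
  toFun x := ⟨fun g => if hg : g ∈ H then σ ⟨g, hg⟩ x else 0, by
    refine ⟨fun h g => ?_, ?_, {1}, isCompact_singleton, fun g hg => ?_⟩
    · by_cases hg : g ∈ H
      · have hhg : (h : G) * g ∈ H := H.mul_mem h.2 hg
        dsimp only
        rw [dif_pos hg, dif_pos hhg, ← Module.End.mul_apply, ← map_mul]
        rfl
      · have hhg : (h : G) * g ∉ H := fun h' => hg ((H.mul_mem_cancel_left h.2).1 h')
        dsimp only
        rw [dif_neg hg, dif_neg hhg, map_zero]
    · refine ⟨(vectorStabilizer σ x).map H.subtype,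
        hH.isOpenEmbedding_subtypeVal.isOpenMap _ (hσ x), ?_⟩
      rintro g _ ⟨k, hk, rfl⟩
      rw [H.subtype_apply]
      by_cases hg : g ∈ H
      · have hgk : g * (k : G) ∈ H := H.mul_mem hg k.2
        have e : (⟨g * k, hgk⟩ : H) = ⟨g, hg⟩ * k := rfl
        dsimp only
        rw [dif_pos hg, dif_pos hgk, e, map_mul, Module.End.mul_apply, show σ k x = x from hk]
      · have hgk : g * (k : G) ∉ H := fun h' => hg ((H.mul_mem_cancel_right k.2).1 h')
        dsimp only
        rw [dif_neg hg, dif_neg hgk]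
    · by_contra hg'
      have : g ∉ H := fun h => hg' (by simpa using h)
      exact hg (dif_neg this)⟩
  map_add' x y := Subtype.ext (funext fun g => by
    by_cases hg : g ∈ H <;> simp [hg])
  map_smul' c x := Subtype.ext (funext fun g => by
    by_cases hg : g ∈ H <;> simp [hg])

theorem toCInd_apply_of_mem (hH : IsOpen (H : Set G)) (hσ : IsSmooth σ) (x : V) {g : G}
    (hg : g ∈ H) : (toCInd hH hσ x).1 g = σ ⟨g, hg⟩ x := dif_pos hg

theorem toCInd_apply_of_notMem (hH : IsOpen (H : Set G)) (hσ : IsSmooth σ) (x : V) {g : G}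
    (hg : g ∉ H) : (toCInd hH hσ x).1 g = 0 := dif_neg hg

variable [IsTopologicalGroup G]

theorem cInd_apply (g y : G) (φ : cIndSpace H σ) : (cInd H σ g φ).1 y = φ.1 (y * g) := rfl

theorem toCInd_rep (hH : IsOpen (H : Set G)) (hσ : IsSmooth σ) (h : H) (x : V) :
    toCInd hH hσ (σ h x) = cInd H σ h (toCInd hH hσ x) := Subtype.ext (funext fun g => by
  rw [cInd_apply]
  by_cases hg : g ∈ H
  · rw [toCInd_apply_of_mem hH hσ _ hg, toCInd_apply_of_mem hH hσ _ (H.mul_mem hg h.2),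
      ← Module.End.mul_apply, ← map_mul]
    rfl
  · rw [toCInd_apply_of_notMem hH hσ _ hg, toCInd_apply_of_notMem hH hσ _
      fun h' => hg ((H.mul_mem_cancel_right h.2).1 h')])

/-- A function supported on finitely many cosets of `H` is a sum of translates of functions
supported on `H`, so an intertwining map on `cInd_H^G σ` is determined by its restriction to `σ`. -/
theorem eq_zero_of_comp_toCInd_eq_zero (hH : IsOpen (H : Set G)) (hσ : IsSmooth σ) {W : Type*}
    [AddCommGroup W] [Module ℂ W] {π : Representation ℂ G W} (F : (cInd H σ).IntertwiningMap π)
    (hF : ∀ x, F (toCInd hH hσ x) = 0) : F = 0 := by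
  classical
  have key : ∀ (t : Finset G) (φ : cIndSpace H σ), Function.support φ.1 ⊆ (H : Set G) * (t : Set G) →
      F φ = 0 := by
    intro t
    induction t using Finset.induction_on with
    | empty =>
      intro φ hφ
      have : φ = 0 := Subtype.ext (Function.support_eq_empty_iff.1 (by simpa using hφ))
      rw [this, map_zero]
    | insert c t _ ih =>
      intro φ hφ
      -- Subtract the restriction of `φ` to the coset `H c`.
      let ψ := cInd H σ c⁻¹ (toCInd hH hσ (φ.1 c))
      have hψ : F ψ = 0 := by
        have := LinearMap.congr_fun (F.isIntertwining' c⁻¹) (toCInd hH hσ (φ.1 c))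
        change F ψ = π c⁻¹ (F (toCInd hH hσ (φ.1 c))) at this
        rw [this, hF, map_zero]
      have hsub : F (φ - ψ) = 0 := by
        refine ih _ fun g hg => ?_
        by_cases hgc : g * c⁻¹ ∈ H
        · refine absurd ?_ hg
          have h1 : ψ.1 g = φ.1 g := by
            change (toCInd hH hσ (φ.1 c)).1 (g * c⁻¹) = _
            rw [toCInd_apply_of_mem hH hσ _ hgc, ← φ.2.1]
            simp
          change φ.1 g - ψ.1 g = 0
          rw [h1, sub_self]
        · have h1 : ψ.1 g = 0 := toCInd_apply_of_notMem hH hσ _ hgc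
          have h2 : g ∈ Function.support φ.1 := fun h0 => hg (by
            change φ.1 g - ψ.1 g = 0
            rw [h0, h1, sub_self])
          obtain ⟨h, hh, d, hd, rfl⟩ := hφ h2
          rcases Finset.mem_insert.1 hd with rfl | hd
          · exact absurd (by simpa using hh) hgc
          · exact ⟨h, hh, d, hd, rfl⟩
      rwa [map_sub, hψ, sub_zero] at hsub
  refine Representation.IntertwiningMap.ext (LinearMap.ext fun φ => ?_)
  obtain ⟨C, hC, hφ⟩ := φ.2.2.2
  obtain ⟨t, -, htf, ht⟩ := hC.elim_finite_subcover_image (b := C)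
    (c := fun c : G => (fun g => g * c⁻¹) ⁻¹' (H : Set G))
    (fun c _ => hH.preimage (continuous_mul_const _)) fun c hc =>
      Set.mem_biUnion hc (by simp [H.one_mem])
  refine key htf.toFinset φ (hφ.trans ?_)
  rintro _ ⟨h, hh, c, hc, rfl⟩
  obtain ⟨d, hd, hcd⟩ := Set.mem_iUnion₂.1 (ht hc)
  exact ⟨h * (c * d⁻¹), H.mul_mem hh hcd, d, by simpa using hd, by simp [mul_assoc]⟩

end Frobenius

/-! ### Theta representations -/

section Theta

variable {G₁ : Type u} {G₂ : Type u'} [Group G₁] [Group G₂] {H₁ : Subgroup G₁} {H₂ : Subgroup G₂}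
  [H₁.Normal] [H₂.Normal]

/-- The two projections of `graphSubgroup γ` and the inclusion of `H₁ × H₂`. -/
def graphDatum (γ : G₁ ⧸ H₁ ≃* G₂ ⧸ H₂) : GraphDatum (graphSubgroup γ) H₁ H₂ where
  fst := (MonoidHom.fst G₁ G₂).comp (graphSubgroup γ).subtype
  snd := (MonoidHom.snd G₁ G₂).comp (graphSubgroup γ).subtype
  incl := prodToGraph γ
  fst_surjective g := by
    obtain ⟨g', hg'⟩ := QuotientGroup.mk'_surjective H₂ (γ (QuotientGroup.mk' H₁ g))
    exact ⟨⟨(g, g'), hg'.symm⟩, rfl⟩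
  snd_surjective g := by
    obtain ⟨g', hg'⟩ := QuotientGroup.mk'_surjective H₁ (γ.symm (QuotientGroup.mk' H₂ g))
    exact ⟨⟨(g', g), (congrArg γ hg').trans (γ.apply_symm_apply _)⟩, rfl⟩
  fst_incl _ := rfl
  snd_incl _ := rfl
  ext _ _ h h' := Subtype.ext (Prod.ext h h')

theorem isOpen_graphSubgroup [TopologicalSpace G₁] [TopologicalSpace G₂] [IsTopologicalGroup G₁]
    [IsTopologicalGroup G₂] (h₁ : IsOpen (H₁ : Set G₁)) (h₂ : IsOpen (H₂ : Set G₂))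
    (γ : G₁ ⧸ H₁ ≃* G₂ ⧸ H₂) : IsOpen (graphSubgroup γ : Set (G₁ × G₂)) :=
  Subgroup.isOpen_mono (H₁ := H₁.prod H₂)
    (fun x hx => (prodToGraph γ (⟨x.1, hx.1⟩, ⟨x.2, hx.2⟩)).2)
    (by rw [Subgroup.coe_prod]; exact h₁.prod h₂)

variable {γ : G₁ ⧸ H₁ ≃* G₂ ⧸ H₂} {V : Type w} [AddCommGroup V] [Module ℂ V]
  {ρ : Representation ℂ (graphSubgroup γ) V}

theorem hasQuotient_of_restrictedHom_ne_bot {W₁ W₂ : Type v} [AddCommGroup W₁] [Module ℂ W₁]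
    [AddCommGroup W₂] [Module ℂ W₂] {τ₁ : Representation ℂ H₁ W₁} {τ₂ : Representation ℂ H₂ W₂}
    (h : (graphDatum γ).restrictedHom ρ τ₁ τ₂ ≠ ⊥) :
    HasQuotient (ρ.comp (prodToGraph γ)) (outerTensor τ₁ τ₂) := by
  obtain ⟨l, hl, hl0⟩ := Submodule.ne_bot_iff _ |>.1 h
  exact ⟨⟨l, fun h => LinearMap.ext (hl h)⟩, fun h0 =>
    hl0 (congrArg Representation.IntertwiningMap.toLinearMap h0)⟩

variable [TopologicalSpace G₁] [IsTopologicalGroup G₁] [TopologicalSpace G₂] [IsTopologicalGroup G₂]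

theorem isThetaOn_of_isTheta [T2Space G₁] [LocallyCompactSpace G₁] [TotallyDisconnectedSpace G₁]
    (hH₁ : IsOpen (H₁ : Set G₁))
    (hadm : IrreduciblesAdmissible.{u, v} H₁)
    (hθ : IsTheta.{u, u', v, w} (ρ.comp (prodToGraph γ))) :
    (graphDatum γ).IsThetaOn.{v} ρ where
  snd_equiv W₁ W₂ W₂' _ _ _ _ _ _ τ₁ τ₂ τ₂' h₁ h₂ h₂' h h' :=
    hθ.1 W₁ W₁ W₂ W₂' τ₁ τ₁ τ₂ τ₂' h₁ h₁ h₂ h₂' (hasQuotient_of_restrictedHom_ne_bot h)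
      (hasQuotient_of_restrictedHom_ne_bot h') ⟨.refl _⟩
  fst_equiv W₁ W₁' W₂ _ _ _ _ _ _ τ₁ τ₁' τ₂ h₁ h₁' h₂ h h' :=
    hθ.2.1 W₁ W₁' W₂ W₂ τ₁ τ₁' τ₂ τ₂ h₁ h₁' h₂ h₂ (hasQuotient_of_restrictedHom_ne_bot h)
      (hasQuotient_of_restrictedHom_ne_bot h') ⟨.refl _⟩
  exists_smul_eq W₁ W₂ _ _ _ _ τ₁ τ₂ h₁ h₂ l hl l' hl' h0 := by
    have : LocallyCompactSpace H₁ := hH₁.isOpenEmbedding_subtypeVal.locallyCompactSpace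
    have hirr : IsSmoothIrreducible (outerTensor τ₁ τ₂) :=
      ⟨h₁.1.outerTensor h₂.1, isIrreducible_outerTensor h₁.2
        (fun f hf => exists_eq_smul_id h₁ (hadm _ _ h₁) hf) h₂.2⟩
    obtain ⟨v, hv⟩ := rank_le_one_iff.1 (hθ.2.2 _ _ hirr)
    obtain ⟨r, hr⟩ := hv ⟨l, fun h => LinearMap.ext (hl h)⟩
    obtain ⟨r', hr'⟩ := hv ⟨l', fun h => LinearMap.ext (hl' h)⟩
    have e : r • v.toLinearMap = l := congrArg Representation.IntertwiningMap.toLinearMap hr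
    have e' : r' • v.toLinearMap = l' := congrArg Representation.IntertwiningMap.toLinearMap hr'
    have hr0 : r ≠ 0 := fun h => h0 (by rw [← e, h, zero_smul])
    exact ⟨r' / r, by rw [← e, smul_smul, div_mul_cancel₀ _ hr0, e']⟩

/-- Frobenius reciprocity: the map `Hom_{G₁ × G₂}(cInd ρ, π₁ ⊗ π₂) → Hom_Γ(ρ, π₁ ⊗ π₂)`. -/
theorem comp_toCInd_mem_graphHom (hΓ : IsOpen (graphSubgroup γ : Set (G₁ × G₂))) (hρ : IsSmooth ρ)
    {V₁ V₂ : Type v} [AddCommGroup V₁] [Module ℂ V₁] [AddCommGroup V₂] [Module ℂ V₂]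
    {π₁ : Representation ℂ G₁ V₁} {π₂ : Representation ℂ G₂ V₂}
    (F : (cInd (graphSubgroup γ) ρ).IntertwiningMap (outerTensor π₁ π₂)) :
    F.toLinearMap ∘ₗ toCInd hΓ hρ ∈ (graphDatum γ).graphHom ρ π₁ π₂ := fun a x => by
  rw [LinearMap.comp_apply, toCInd_rep]
  exact LinearMap.congr_fun (F.isIntertwining' a) _

theorem exists_graphHom_ne_zero (hΓ : IsOpen (graphSubgroup γ : Set (G₁ × G₂))) (hρ : IsSmooth ρ)
    {V₁ V₂ : Type v} [AddCommGroup V₁] [Module ℂ V₁] [AddCommGroup V₂] [Module ℂ V₂]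
    {π₁ : Representation ℂ G₁ V₁} {π₂ : Representation ℂ G₂ V₂}
    (h : HasQuotient (cInd (graphSubgroup γ) ρ) (outerTensor π₁ π₂)) :
    ∃ f ∈ (graphDatum γ).graphHom ρ π₁ π₂, f ≠ 0 := by
  obtain ⟨F, hF⟩ := h
  exact ⟨_, comp_toCInd_mem_graphHom hΓ hρ F, fun h0 => hF
    (eq_zero_of_comp_toCInd_eq_zero hΓ hρ F fun x => LinearMap.congr_fun h0 x)⟩

end Theta

end SmoothRep

open GraphDatum in
theorem theorem9p1 {G₁ : Type u} {G₂ : Type u'}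
    [Group G₁] [TopologicalSpace G₁] [IsTopologicalGroup G₁]
    [T2Space G₁] [LocallyCompactSpace G₁] [TotallyDisconnectedSpace G₁] [SigmaCompactSpace G₁]
    [Group G₂] [TopologicalSpace G₂] [IsTopologicalGroup G₂]
    [T2Space G₂] [LocallyCompactSpace G₂] [TotallyDisconnectedSpace G₂] [SigmaCompactSpace G₂]
    (H₁ : Subgroup G₁) (H₂ : Subgroup G₂) [H₁.Normal] [H₂.Normal]
    (hH₁ : IsOpen (H₁ : Set G₁)) (hH₂ : IsOpen (H₂ : Set G₂))
    (γ : G₁ ⧸ H₁ ≃* G₂ ⧸ H₂) (hab : ∀ a b : G₁ ⧸ H₁, a * b = b * a)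
    (hadmG₁ : IrreduciblesAdmissible.{u, v} G₁)
    (hadmG₂ : IrreduciblesAdmissible.{u', v} G₂)
    (hadmG : IrreduciblesAdmissible.{max u u', v} (G₁ × G₂))
    (hadmH₁ : IrreduciblesAdmissible.{u, v} H₁)
    (hadmH₂ : IrreduciblesAdmissible.{u', v} H₂)
    (hquot₁ : ∀ (V₁ : Type v) [AddCommGroup V₁] [Module ℂ V₁] (π₁ : Representation ℂ G₁ V₁),
      IsSmoothIrreducible π₁ → HasIrreducibleQuotient.{u, v, v} (π₁.comp H₁.subtype))
    (hquot₂ : ∀ (V₂ : Type v) [AddCommGroup V₂] [Module ℂ V₂] (π₂ : Representation ℂ G₂ V₂),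
      IsSmoothIrreducible π₂ → HasIrreducibleQuotient.{u', v, v} (π₂.comp H₂.subtype))
    {V : Type w} [AddCommGroup V] [Module ℂ V] (ρ : Representation ℂ (graphSubgroup γ) V)
    (hρ : IsSmooth ρ) (hθ : IsTheta.{u, u', v, w} (ρ.comp (prodToGraph γ))) :
    IsTheta.{u, u', v, max u u' w} (cInd (graphSubgroup γ) ρ) := by
  have hΓ := isOpen_graphSubgroup hH₁ hH₂ γ
  have hθ' := isThetaOn_of_isTheta hH₁ hadmH₁ hθ
  have hp₁ : IsAdmissiblePair.{v} H₁ := ⟨hH₁, hadmG₁, hadmH₁, hquot₁⟩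
  have hp₂ : IsAdmissiblePair.{v} H₂ := ⟨hH₂, hadmG₂, hadmH₂, hquot₂⟩
  refine ⟨?_, ?_, ?_⟩
  · intro V₁ V₁' V₂ V₂' _ _ _ _ _ _ _ _ π₁ π₁' π₂ π₂' h₁ h₁' h₂ h₂' hq hq' ⟨e⟩
    obtain ⟨f, hf, hf0⟩ := exists_graphHom_ne_zero hΓ hρ hq
    obtain ⟨f', hf', hf0'⟩ := exists_graphHom_ne_zero hΓ hρ hq'
    refine exists_equiv_of_graphHom hθ' hp₁ hp₂ h₁ h₂ h₂' hf hf0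
      (map_comp_mem_graphHom hf' (equiv_apply_rep e.symm) (j₂ := LinearMap.id) fun _ _ => rfl)
      fun h => hf0' ?_
    exact LinearMap.ext fun x => (e.toLinearEquiv.symm.rTensor V₂').injective (by
      rw [LinearMap.zero_apply, map_zero]; exact LinearMap.congr_fun h x)
  · intro V₁ V₁' V₂ V₂' _ _ _ _ _ _ _ _ π₁ π₁' π₂ π₂' h₁ h₁' h₂ h₂' hq hq' ⟨e⟩
    obtain ⟨f, hf, hf0⟩ := exists_graphHom_ne_zero hΓ hρ hq
    obtain ⟨f', hf', hf0'⟩ := exists_graphHom_ne_zero hΓ hρ hq'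
    refine exists_equiv_of_graphHom hθ'.swap hp₂ hp₁ h₂ h₁ h₁' (comm_comp_mem_graphHom hf)
      (fun h => hf0 (comm_comp_eq_zero h)) (comm_comp_mem_graphHom
      (map_comp_mem_graphHom hf' (j₁ := LinearMap.id) (fun _ _ => rfl) (equiv_apply_rep e.symm)))
      fun h => hf0' ?_
    exact LinearMap.ext fun x => (e.toLinearEquiv.symm.lTensor V₁').injective (by
      rw [LinearMap.zero_apply, map_zero]; exact LinearMap.congr_fun (comm_comp_eq_zero h) x)
  · intro W _ _ σ hσ
    obtain ⟨V₁, V₂, _, _, _, _, π₁, π₂, h₁, h₂, ⟨e⟩⟩ :=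
      exists_equiv_outerTensor hσ (hadmG W σ hσ) hadmG₁
    refine rank_le_one_iff.2 ?_
    by_cases h0 : ∀ F : (cInd (graphSubgroup γ) ρ).IntertwiningMap σ, F = 0
    · exact ⟨0, fun F => ⟨0, by rw [h0 F, smul_zero]⟩⟩
    push Not at h0
    obtain ⟨F, hF⟩ := h0
    have hinj : ∀ F' : (cInd (graphSubgroup γ) ρ).IntertwiningMap σ,
        (e.toIntertwiningMap.comp F').toLinearMap ∘ₗ toCInd hΓ hρ = 0 → F' = 0 := fun F' h =>
      eq_zero_of_comp_toCInd_eq_zero hΓ hρ F' fun x => e.toLinearEquiv.injective (by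
        rw [map_zero]; exact LinearMap.congr_fun h x)
    refine ⟨F, fun F' => ?_⟩
    obtain ⟨c, hc⟩ := exists_smul_eq_of_graphHom hθ' hp₁ hp₂ h₁ h₂
      (comp_toCInd_mem_graphHom hΓ hρ (e.toIntertwiningMap.comp F)) (fun h => hF (hinj F h))
      (comp_toCInd_mem_graphHom hΓ hρ (e.toIntertwiningMap.comp F'))
    refine ⟨c, sub_eq_zero.1 (hinj _ (LinearMap.ext fun x => ?_))⟩
    have := LinearMap.congr_fun hc x
    change c • e (F (toCInd hΓ hρ x)) = e (F' (toCInd hΓ hρ x)) at this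
    change e (c • F (toCInd hΓ hρ x) - F' (toCInd hΓ hρ x)) = 0
    rw [map_sub, map_smul, this, sub_self]
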